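/- Let $\Bbbk$ be a field. Let $\mathcal{A}s$ be the $\Bbbk$-linear symmetric operad of unital associative algebras, so $\mathcal{A}s(n)=\Bbbk\mathbb{S}_n$ for $n\ge 0$, with identity $\mathbb{1}\in\mathcal{A}s(1)$ and $\mathbb{1}_0$ the identity permutation in $\mathcal{A}s(0)=\Bbbk\mathbb{S}_0$. Let $\mathcal{C}om$ be the operad of unital commutative associative algebras, $\mathcal{C}om(n)=\Bbbk$ for all $n\ge 0$. For $I\subseteq\{1,\dots,n\}$ let $\pi^I:\mathcal{A}s(n)\to\mathcal{A}s(|I|)$ be the map $\theta\mapsto\theta\circ(u_1,\dots,u_n)$, where $u_i=\mathbb{1}$ if $i\in I$ and $u_i=\mathbb{1}_0$ if $i\notin I$. For $k\ge 1$ the $k$-th truncation ${}^k\Upsilon$ of $\mathcal{A}s$ is given by ${}^k\Upsilon(n)=\bigcap_{|I|=k-1}\ker\pi^I$ for $n\ge k$ and ${}^k\Upsilon(n)=0$ for $n<k$. For an operad $\mathcal{P}$ put $\operatorname{GKdim}\mathcal{P}=\limsup_{n\to\infty}\log_n\bigl(\sum_{i=0}^n\dim_\Bbbk\mathcal{P}(i)\bigr)$.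 **Theorem.** Let $\mathcal{P}=\mathcal{A}s/\mathcal{I}$ be a quotient operad of $\mathcal{A}s$ by an operadic ideal $\mathcal{I}$. 1. If $\operatorname{GKdim}\mathcal{P}=1$, then $\mathcal{I}={}^1\Upsilon$, that is $\mathcal{P}=\mathcal{A}s/{}^1\Upsilon$, and $\mathcal{P}\cong\mathcal{C}om$ as operads. 2. $\operatorname{GKdim}\mathcal{P}$ cannot be $2$, and cannot be strictly between $1$ and $3$. 3. If $\operatorname{GKdim}\mathcal{P}=3$, then $\mathcal{I}={}^3\Upsilon$, that is $\mathcal{P}=\mathcal{A}s/{}^3\Upsilon$. 4. If $\operatorname{GKdim}\mathcal{P}=4$ and $\operatorname{char}\Bbbk\neq 3$, then $\mathcal{I}={}^4\Upsilon$, that is $\mathcal{P}=\mathcal{A}s/{}^4\Upsilon$. 5. There are at least two non-isomorphic quotient operads of $\mathcal{A}s$ of GKdimension $5$. -/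

import Mathlib

open Equiv

/-! ### Blocks and block permutations -/

/-- The division of `{1, …, m}`, `m = k 1 + ⋯ + k n`, into consecutive blocks of sizes
`k 1, …, k n`: the pair `⟨i, j⟩` is sent to the `j`-th element of the `i`-th block. -/
def blockEquiv {n m : ℕ} (k : Fin n → ℕ) (h : ∑ i, k i = m) : (Σ i, Fin (k i)) ≃ Fin m :=
  finSigmaFinEquiv.trans (finCongr h)

theorem blockEquiv_lt {n m : ℕ} (k : Fin n → ℕ) (h : ∑ i, k i = m) (x y : Σ i, Fin (k i)) :
    blockEquiv k h x < blockEquiv k h y ↔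
      x.1 < y.1 ∨ (x.1 = y.1 ∧ (x.2 : ℕ) < (y.2 : ℕ)) := by
  have key : ∀ x y : Σ i, Fin (k i), x.1 < y.1 →
      ((finSigmaFinEquiv x : Fin _) : ℕ) < ((finSigmaFinEquiv y : Fin _) : ℕ) := by
    rintro ⟨i, a⟩ ⟨j, b⟩ hij
    simp only [finSigmaFinEquiv_apply]
    have hij' : (i : ℕ) + 1 ≤ j := hij
    obtain ⟨d, hd⟩ := Nat.exists_eq_add_of_le hij'
    have e : ∑ t : Fin (j : ℕ), k (Fin.castLE j.2.le t) =
        ∑ t ∈ Finset.range (j : ℕ), (if ht : t < n then k ⟨t, ht⟩ else 0) := by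
      rw [Finset.sum_range]
      refine Finset.sum_congr rfl fun t _ => ?_
      rw [dif_pos (t.2.trans j.2)]; rfl
    have e' : ∑ t : Fin (i : ℕ), k (Fin.castLE i.2.le t) =
        ∑ t ∈ Finset.range (i : ℕ), (if ht : t < n then k ⟨t, ht⟩ else 0) := by
      rw [Finset.sum_range]
      refine Finset.sum_congr rfl fun t _ => ?_
      rw [dif_pos (t.2.trans i.2)]; rfl
    have e'' : ∑ t ∈ Finset.range ((i : ℕ) + 1), (if ht : t < n then k ⟨t, ht⟩ else 0) ≤
        ∑ t ∈ Finset.range (j : ℕ), (if ht : t < n then k ⟨t, ht⟩ else 0) :=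
      Finset.sum_le_sum_of_subset (Finset.range_mono hij')
    rw [Finset.sum_range_succ, dif_pos i.2] at e''
    have ha : (a : ℕ) < k ⟨(i : ℕ), i.2⟩ := a.2
    change ∑ t : Fin (i : ℕ), k (Fin.castLE i.2.le t) + (a : ℕ) <
      ∑ t : Fin (j : ℕ), k (Fin.castLE j.2.le t) + (b : ℕ)
    omega
  have hval : ∀ x, ((blockEquiv k h x : Fin m) : ℕ) = ((finSigmaFinEquiv x : Fin _) : ℕ) :=
    fun x => rfl
  rw [Fin.lt_def, hval, hval]
  rcases lt_trichotomy x.1 y.1 with hlt | heq | hgt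
  · exact iff_of_true (key x y hlt) (Or.inl hlt)
  · obtain ⟨i, a⟩ := x
    obtain ⟨j, b⟩ := y
    obtain rfl : i = j := heq
    simp [finSigmaFinEquiv_apply]
  · refine iff_of_false (not_lt.2 (key y x hgt).le) ?_
    rintro (h1 | ⟨h1, _⟩)
    · exact lt_asymm h1 hgt
    · exact hgt.ne' h1

theorem equiv_fin_ext {X : Type*} {t : ℕ} (e f : X ≃ Fin t)
    (h : ∀ x y, e x < e y ↔ f x < f y) : e = f := by
  have hm : ∀ a b : Fin t, (e.symm.trans f) a ≤ (e.symm.trans f) b ↔ a ≤ b := by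
    intro a b
    rw [← not_lt, ← not_lt]
    simpa using (not_congr (h (e.symm b) (e.symm a))).symm
  let o : Fin t ≃o Fin t := ⟨e.symm.trans f, fun {a b} => hm a b⟩
  have ho : o = OrderIso.refl _ := Subsingleton.elim _ _
  ext x
  have := congrArg (fun q : Fin t ≃o Fin t => q (e x)) ho
  have h2 : f x = e x := by simpa [o] using this
  rw [h2]

theorem block_sum {n m t : ℕ} {k : Fin n → ℕ} (hk : ∑ i, k i = m) (l : ∀ i, Fin (k i) → ℕ)
    {s : Fin n → ℕ} (hl : ∀ i, ∑ j, l i j = s i) (hs : ∑ i, s i = t) :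
    ∑ p : Fin m, l ((blockEquiv k hk).symm p).1 ((blockEquiv k hk).symm p).2 = t := by
  rw [Equiv.sum_comp (blockEquiv k hk).symm (fun x : Σ i, Fin (k i) => l x.1 x.2),
    Fintype.sum_sigma, ← hs]
  exact Finset.sum_congr rfl fun i _ => hl i

/-- The block permutation `ϑ(σ; τ 1, …, τ n)`: it applies `τ i` inside the `i`-th block and
moves the `i`-th block to place `σ i`. Written as the sequence of its inverse values it is
`(B̃_{σ⁻¹ 1}, …, B̃_{σ⁻¹ n})`, where `B̃ i` is the `i`-th block in the order given by `τ i`. -/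
def blockPerm {n m : ℕ} (k : Fin n → ℕ) (h : ∑ i, k i = m) (σ : Perm (Fin n))
    (τ : ∀ i, Perm (Fin (k i))) : Perm (Fin m) :=
  (blockEquiv k h).symm.trans <|
    ((sigmaCongrRight τ).trans (sigmaCongrLeft' σ)).trans <|
      blockEquiv (fun a => k (σ.symm a)) ((Equiv.sum_comp σ.symm k).trans h)

theorem sigmaCongrLeft'_fst {n : ℕ} {k : Fin n → ℕ} (σ : Perm (Fin n)) (x : Σ i, Fin (k i)) :
    (sigmaCongrLeft' (β := fun i => Fin (k i)) σ x).1 = σ x.1 := rfl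

theorem sigmaCongrLeft'_snd {n : ℕ} {k : Fin n → ℕ} (σ : Perm (Fin n)) (x : Σ i, Fin (k i)) :
    ((sigmaCongrLeft' (β := fun i => Fin (k i)) σ x).2 : ℕ) = x.2 := by
  obtain ⟨y, rfl⟩ := (sigmaCongrLeft' (β := fun i => Fin (k i)) σ).symm.surjective x
  rw [apply_symm_apply]
  rfl

theorem blockPerm_lt {n m : ℕ} (k : Fin n → ℕ) (h : ∑ i, k i = m) (σ : Perm (Fin n))
    (τ : ∀ i, Perm (Fin (k i))) (x y : Σ i, Fin (k i)) :
    blockPerm k h σ τ (blockEquiv k h x) < blockPerm k h σ τ (blockEquiv k h y) ↔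
      σ x.1 < σ y.1 ∨ (x.1 = y.1 ∧ (τ x.1 x.2 : ℕ) < (τ y.1 y.2 : ℕ)) := by
  simp only [blockPerm, trans_apply, symm_apply_apply, blockEquiv_lt, sigmaCongrLeft'_fst,
    sigmaCongrLeft'_snd]
  simp
  exact Iff.rfl

/-- Block permutations are compatible with products. -/
theorem blockPerm_mul {n m : ℕ} (k : Fin n → ℕ) (h : ∑ i, k i = m)
    (h' : ∀ σ : Perm (Fin n), ∑ i, k (σ.symm i) = m) (ρ σ : Perm (Fin n))
    (ρ' τ : ∀ i, Perm (Fin (k i))) :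
    blockPerm k h (ρ * σ) (fun i => ρ' i * τ i) =
      blockPerm (fun i => k (σ.symm i)) (h' σ) ρ (fun i => ρ' (σ.symm i)) *
        blockPerm k h σ τ := by
  apply equiv_fin_ext
  intro x y
  obtain ⟨⟨i, a⟩, rfl⟩ := (blockEquiv k h).surjective x
  obtain ⟨⟨j, b⟩, rfl⟩ := (blockEquiv k h).surjective y
  rw [blockPerm_lt]
  have e : ∀ i (a : Fin (k i)), blockPerm k h σ τ (blockEquiv k h ⟨i, a⟩) =
      blockEquiv (fun i => k (σ.symm i)) (h' σ)
        (sigmaCongrLeft' (β := fun i => Fin (k i)) σ ⟨i, τ i a⟩) := by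
    intro i a
    simp [blockPerm]
  change _ ↔ blockPerm _ (h' σ) ρ (fun i => ρ' (σ.symm i)) (blockPerm k h σ τ _) <
    blockPerm _ (h' σ) ρ (fun i => ρ' (σ.symm i)) (blockPerm k h σ τ _)
  rw [e, e, blockPerm_lt]
  have e2 : ∀ i (c : Fin (k i)),
      (((fun i => ρ' (σ.symm i)) (sigmaCongrLeft' (β := fun i => Fin (k i)) σ ⟨i, c⟩).1
        (sigmaCongrLeft' (β := fun i => Fin (k i)) σ ⟨i, c⟩).2 : Fin _) : ℕ) = ρ' i c := by
    intro i c
    obtain ⟨⟨u, v⟩, huv⟩ := (sigmaCongrLeft' (β := fun i => Fin (k i)) σ).symm.surjective ⟨i, c⟩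
    rw [← huv, apply_symm_apply]
    have hi : i = σ.symm u := by
      have := congrArg Sigma.fst huv
      exact this.symm
    subst hi
    have hc : c = v := by
      have : (⟨σ.symm u, v⟩ : Σ i, Fin (k i)) = ⟨σ.symm u, c⟩ := huv
      simpa using this.symm
    rw [hc]
  rw [e2, e2]
  simp [sigmaCongrLeft'_fst]

theorem blockEquiv_assoc {n m t : ℕ} {k : Fin n → ℕ} (hk : ∑ i, k i = m)
    (l : ∀ i, Fin (k i) → ℕ) {s : Fin n → ℕ} (hl : ∀ i, ∑ j, l i j = s i) (hs : ∑ i, s i = t)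
    (ht : ∑ p : Fin m, l ((blockEquiv k hk).symm p).1 ((blockEquiv k hk).symm p).2 = t)
    (x : Σ i, Fin (k i)) (r : Fin (l x.1 x.2)) (p : Fin m) (hp : (blockEquiv k hk).symm p = x)
    (r' : Fin (l ((blockEquiv k hk).symm p).1 ((blockEquiv k hk).symm p).2))
    (hr : (r' : ℕ) = r) :
    blockEquiv s hs ⟨x.1, blockEquiv (l x.1) (hl x.1) ⟨x.2, r⟩⟩ =
      blockEquiv (fun p : Fin m => l ((blockEquiv k hk).symm p).1 ((blockEquiv k hk).symm p).2)
        ht ⟨p, r'⟩ := by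
  -- both sides are order isomorphisms from the lexicographically ordered set of triples
  let E : (Σ i, Σ j, Fin (l i j)) ≃ Fin t :=
    (sigmaCongrRight fun i => blockEquiv (l i) (hl i)).trans (blockEquiv s hs)
  let A : (Σ x : Σ i, Fin (k i), Fin (l x.1 x.2)) ≃
      Σ p : Fin m, Fin (l ((blockEquiv k hk).symm p).1 ((blockEquiv k hk).symm p).2) :=
    (sigmaCongrLeft (β := fun x : Σ i, Fin (k i) => Fin (l x.1 x.2)) (blockEquiv k hk).symm).symm
  let F : (Σ i, Σ j, Fin (l i j)) ≃ Fin t :=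
    ((sigmaAssoc fun i j => Fin (l i j)).symm.trans A).trans
      (blockEquiv (fun p : Fin m => l ((blockEquiv k hk).symm p).1 ((blockEquiv k hk).symm p).2)
        ht)
  have hA1 : ∀ z, (A z).1 = blockEquiv k hk z.1 := fun z => rfl
  have hA2 : ∀ z, ((A z).2 : ℕ) = z.2 := by
    intro z
    obtain ⟨y, rfl⟩ := A.symm.surjective z
    rw [apply_symm_apply]
    rfl
  have hEF : E = F := by
    apply equiv_fin_ext
    rintro ⟨i, j, a⟩ ⟨i', j', a'⟩
    simp only [E, F, trans_apply, blockEquiv_lt, hA1, hA2]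
    simp only [sigmaCongrRight_apply]
    constructor
    · rintro (h1 | ⟨h1, h2⟩)
      · exact Or.inl (Or.inl h1)
      · obtain rfl : i = i' := h1
        have h2' : blockEquiv (l i) (hl i) ⟨j, a⟩ < blockEquiv (l i) (hl i) ⟨j', a'⟩ := h2
        rw [blockEquiv_lt] at h2'
        rcases h2' with h3 | ⟨h3, h4⟩
        · exact Or.inl (Or.inr ⟨rfl, h3⟩)
        · obtain rfl : j = j' := h3
          exact Or.inr ⟨rfl, h4⟩
    · rintro (h1 | ⟨h1, h2⟩)
      · rcases h1 with h1 | ⟨h1, h3⟩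
        · exact Or.inl h1
        · obtain rfl : i = i' := h1
          refine Or.inr ⟨rfl, ?_⟩
          exact (blockEquiv_lt _ _ _ _).2 (Or.inl h3)
      · have h3 := (blockEquiv k hk).injective h1
        obtain ⟨rfl, h4⟩ := Sigma.mk.inj_iff.1 h3
        obtain rfl := eq_of_heq h4
        refine Or.inr ⟨rfl, ?_⟩
        exact (blockEquiv_lt _ _ _ _).2 (Or.inr ⟨rfl, h2⟩)
  have h1 := congrArg (fun e : (Σ i, Σ j, Fin (l i j)) ≃ Fin t => e ⟨x.1, x.2, r⟩) hEF
  have h2 : A ⟨x, r⟩ = ⟨p, r'⟩ := by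
    subst hp
    have h3 : A ⟨(blockEquiv k hk).symm p, r⟩ = ⟨p, r⟩ := by
      rw [← A.eq_symm_apply]; rfl
    rw [h3]
    congr 1
    exact Fin.ext hr.symm
  calc _ = E ⟨x.1, x.2, r⟩ := rfl
    _ = F ⟨x.1, x.2, r⟩ := h1
    _ = _ := by rw [← h2]; rfl

theorem blockPerm_assoc {n m t : ℕ} {k : Fin n → ℕ} (hk : ∑ i, k i = m)
    (l : ∀ i, Fin (k i) → ℕ) {s : Fin n → ℕ} (hl : ∀ i, ∑ j, l i j = s i) (hs : ∑ i, s i = t)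
    (ht : ∑ p : Fin m, l ((blockEquiv k hk).symm p).1 ((blockEquiv k hk).symm p).2 = t)
    (σ : Perm (Fin n)) (τ : ∀ i, Perm (Fin (k i))) (ρ : ∀ i j, Perm (Fin (l i j))) :
    blockPerm s hs σ (fun i => blockPerm (l i) (hl i) (τ i) (ρ i)) =
      blockPerm (fun p : Fin m => l ((blockEquiv k hk).symm p).1 ((blockEquiv k hk).symm p).2)
        ht (blockPerm k hk σ τ)
        (fun p => ρ ((blockEquiv k hk).symm p).1 ((blockEquiv k hk).symm p).2) := by
  apply equiv_fin_ext
  intro x y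
  obtain ⟨⟨p, r⟩, rfl⟩ := (blockEquiv _ ht).surjective x
  obtain ⟨⟨q, r'⟩, rfl⟩ := (blockEquiv _ ht).surjective y
  rw [blockPerm_lt, ← blockEquiv_assoc hk l hl hs ht _ r p rfl r rfl,
    ← blockEquiv_assoc hk l hl hs ht _ r' q rfl r' rfl, blockPerm_lt]
  have e1 := blockPerm_lt k hk σ τ ((blockEquiv k hk).symm p) ((blockEquiv k hk).symm q)
  rw [apply_symm_apply, apply_symm_apply] at e1
  have e2 : p = q ↔ (blockEquiv k hk).symm p = (blockEquiv k hk).symm q :=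
    (EmbeddingLike.apply_eq_iff_eq _).symm
  rw [e1, e2]
  suffices key : ∀ (X Y : Σ i, Fin (k i)) (r : Fin (l X.1 X.2)) (r' : Fin (l Y.1 Y.2)),
      (σ X.1 < σ Y.1 ∨ (X.1 = Y.1 ∧
        (blockPerm (l X.1) (hl X.1) (τ X.1) (ρ X.1)
          (blockEquiv (l X.1) (hl X.1) ⟨X.2, r⟩) : ℕ) <
        (blockPerm (l Y.1) (hl Y.1) (τ Y.1) (ρ Y.1)
          (blockEquiv (l Y.1) (hl Y.1) ⟨Y.2, r'⟩) : ℕ))) ↔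
      ((σ X.1 < σ Y.1 ∨ (X.1 = Y.1 ∧ (τ X.1 X.2 : ℕ) < (τ Y.1 Y.2 : ℕ))) ∨
        (X = Y ∧ (ρ X.1 X.2 r : ℕ) < (ρ Y.1 Y.2 r' : ℕ))) from
    key _ _ r r'
  rintro ⟨i, j⟩ ⟨i', j'⟩ r r'
  constructor
  · rintro (h1 | ⟨h1, h2⟩)
    · exact Or.inl (Or.inl h1)
    · obtain rfl : i = i' := h1
      have h2' := (blockPerm_lt (l i) (hl i) (τ i) (ρ i) ⟨j, r⟩ ⟨j', r'⟩).1 h2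
      rcases h2' with h3 | ⟨h3, h4⟩
      · exact Or.inl (Or.inr ⟨rfl, h3⟩)
      · obtain rfl : j = j' := h3
        exact Or.inr ⟨rfl, h4⟩
  · rintro ((h1 | ⟨h1, h3⟩) | ⟨h1, h2⟩)
    · exact Or.inl h1
    · obtain rfl : i = i' := h1
      exact Or.inr ⟨rfl, (blockPerm_lt (l i) (hl i) (τ i) (ρ i) ⟨j, r⟩ ⟨j', r'⟩).2 (Or.inl h3)⟩
    · obtain ⟨rfl, h4⟩ := Sigma.mk.inj_iff.1 h1
      obtain rfl := eq_of_heq h4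
      exact Or.inr ⟨rfl, (blockPerm_lt (l i) (hl i) (τ i) (ρ i) ⟨j, r⟩ ⟨j, r'⟩).2
        (Or.inr ⟨rfl, h2⟩)⟩

theorem blockPerm_one {n m : ℕ} (k : Fin n → ℕ) (h : ∑ i, k i = m) :
    blockPerm k h 1 (fun _ => 1) = 1 := by
  apply equiv_fin_ext
  intro x y
  obtain ⟨x, rfl⟩ := (blockEquiv k h).surjective x
  obtain ⟨y, rfl⟩ := (blockEquiv k h).surjective y
  rw [blockPerm_lt]
  simp [blockEquiv_lt]

theorem blockPerm_one_left {n : ℕ} (h : ∑ _i : Fin 1, n = n) (τ : Perm (Fin n)) :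
    blockPerm (fun _ : Fin 1 => n) h 1 (fun _ => τ) = τ := by
  have e : ∀ a : Fin n, blockEquiv (fun _ : Fin 1 => n) h ⟨0, a⟩ = a := by
    intro a
    ext
    simp [blockEquiv]
  apply equiv_fin_ext
  intro x y
  rw [← e x, ← e y, blockPerm_lt, e, e]
  simp

theorem blockPerm_one_right {n : ℕ} (h : ∑ _i : Fin n, 1 = n) (σ : Perm (Fin n)) :
    blockPerm (fun _ : Fin n => 1) h σ (fun _ => 1) = σ := by
  have e : ∀ a : Fin n, blockEquiv (fun _ : Fin n => 1) h ⟨a, 0⟩ = a := by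
    intro a
    ext
    simp [blockEquiv, finSigmaFinEquiv_apply]
  apply equiv_fin_ext
  intro x y
  rw [← e x, ← e y, blockPerm_lt, e, e]
  simp

/-! ### Linear operads -/

universe u v w

/-- A `𝕜`-linear symmetric operad (classical definition): right `𝕜 S_n`-modules `obj n`, an
identity in `obj 1` and multilinear composition maps
`(θ, θ 1, …, θ n) ↦ θ ∘ (θ 1, …, θ n)`, `obj n × obj (k 1) × ⋯ × obj (k n) → obj m`, where
`m = k 1 + ⋯ + k n`. The arity `m` of the composite is a separate argument, together with a proof
of that equality, so that the axioms need no transport between equal arities. (For `n = 0` the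
axiom `comp_one` says that `θ ∘ () = θ`.) -/
structure SymmOperad (𝕜 : Type u) [Field 𝕜] where
  /-- the `n`-ary operations -/
  obj : ℕ → Type v
  [addCommGroup : ∀ n, AddCommGroup (obj n)]
  [module : ∀ n, Module 𝕜 (obj n)]
  /-- the right action `θ ∗ σ` of the symmetric group -/
  act : ∀ {n : ℕ}, Perm (Fin n) → obj n →ₗ[𝕜] obj n
  /-- the identity -/
  one : obj 1
  /-- the composition `θ ∘ (θ 1, …, θ n)` -/
  comp : ∀ {n m : ℕ} (k : Fin n → ℕ) (_ : ∑ i, k i = m),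
    obj n →ₗ[𝕜] MultilinearMap 𝕜 (fun i => obj (k i)) (obj m)
  act_one : ∀ {n : ℕ} (θ : obj n), act 1 θ = θ
  act_mul : ∀ {n : ℕ} (σ τ : Perm (Fin n)) (θ : obj n), act (σ * τ) θ = act τ (act σ θ)
  comp_one : ∀ {n : ℕ} (h : ∑ _i : Fin n, 1 = n) (θ : obj n),
    comp (fun _ : Fin n => 1) h θ (fun _ => one) = θ
  one_comp : ∀ {n : ℕ} (h : ∑ _i : Fin 1, n = n) (θ : obj n),
    comp (fun _ : Fin 1 => n) h one (fun _ => θ) = θ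
  assoc : ∀ {n m t : ℕ} {k : Fin n → ℕ} (hk : ∑ i, k i = m) {l : ∀ i, Fin (k i) → ℕ}
    {s : Fin n → ℕ} (hl : ∀ i, ∑ j, l i j = s i) (hs : ∑ i, s i = t)
    (θ : obj n) (φ : ∀ i, obj (k i)) (ψ : ∀ i j, obj (l i j)),
    comp s hs θ (fun i => comp (l i) (hl i) (φ i) (ψ i)) =
      comp (fun p : Fin m => l ((blockEquiv k hk).symm p).1 ((blockEquiv k hk).symm p).2)
        (block_sum hk l hl hs) (comp k hk θ φ)
        (fun p => ψ ((blockEquiv k hk).symm p).1 ((blockEquiv k hk).symm p).2)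
  equivariance : ∀ {n m : ℕ} {k : Fin n → ℕ} (hk : ∑ i, k i = m)
    (σ : Perm (Fin n)) (τ : ∀ i, Perm (Fin (k i))) (θ : obj n) (φ : ∀ i, obj (k i)),
    comp k hk (act σ θ) (fun i => act (τ i) (φ i)) =
      act (blockPerm k hk σ τ)
        (comp (fun i => k (σ.symm i)) ((Equiv.sum_comp σ.symm k).trans hk) θ
          (fun i => φ (σ.symm i)))

attribute [instance] SymmOperad.addCommGroup SymmOperad.module

/-- Evaluation of a linear family of multilinear maps at fixed arguments. -/
def evalLinear {𝕜 : Type*} [Field 𝕜] {ι A N : Type*} {M : ι → Type*} [AddCommGroup A]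
    [Module 𝕜 A] [∀ i, AddCommGroup (M i)] [∀ i, Module 𝕜 (M i)] [AddCommGroup N] [Module 𝕜 N]
    (f : A →ₗ[𝕜] MultilinearMap 𝕜 M N) (x : ∀ i, M i) : A →ₗ[𝕜] N where
  toFun a := f a x
  map_add' a b := by simp
  map_smul' c a := by simp

namespace SymmOperad

variable {𝕜 : Type u} [Field 𝕜]

/-! ### Morphisms, ideals, quotients -/

/-- A morphism of operads. -/
structure Hom (P : SymmOperad.{u, v} 𝕜) (Q : SymmOperad.{u, w} 𝕜) where
  toFun : ∀ n, P.obj n →ₗ[𝕜] Q.obj n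
  map_act : ∀ {n : ℕ} (σ : Perm (Fin n)) (θ : P.obj n),
    toFun n (P.act σ θ) = Q.act σ (toFun n θ)
  map_one : toFun 1 P.one = Q.one
  map_comp : ∀ {n m : ℕ} (k : Fin n → ℕ) (h : ∑ i, k i = m) (θ : P.obj n)
    (φ : ∀ i, P.obj (k i)),
    toFun m (P.comp k h θ φ) = Q.comp k h (toFun n θ) (fun i => toFun (k i) (φ i))

/-- Two operads are isomorphic if there are mutually inverse morphisms between them. -/
def Isomorphic (P : SymmOperad.{u, v} 𝕜) (Q : SymmOperad.{u, w} 𝕜) : Prop :=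
  ∃ (f : Hom P Q) (g : Hom Q P),
    (∀ n x, g.toFun n (f.toFun n x) = x) ∧ (∀ n y, f.toFun n (g.toFun n y) = y)

/-- An operadic ideal: a family of `S_n`-submodules such that `θ ∘ (θ 1, …, θ n)` belongs to the
family as soon as one of `θ, θ 1, …, θ n` does. -/
structure OperadicIdeal (P : SymmOperad.{u, v} 𝕜) where
  carrier : ∀ n, Submodule 𝕜 (P.obj n)
  act_mem : ∀ {n : ℕ} (σ : Perm (Fin n)) {θ : P.obj n}, θ ∈ carrier n → P.act σ θ ∈ carrier n
  comp_mem_left : ∀ {n m : ℕ} (k : Fin n → ℕ) (h : ∑ i, k i = m) {θ : P.obj n}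
    (φ : ∀ i, P.obj (k i)), θ ∈ carrier n → P.comp k h θ φ ∈ carrier m
  comp_mem_right : ∀ {n m : ℕ} (k : Fin n → ℕ) (h : ∑ i, k i = m) (θ : P.obj n)
    {φ : ∀ i, P.obj (k i)} (i : Fin n), φ i ∈ carrier (k i) → P.comp k h θ φ ∈ carrier m

namespace OperadicIdeal

variable {P : SymmOperad.{u, v} 𝕜} (I : OperadicIdeal P)

theorem comp_sub_mem {n m : ℕ} (k : Fin n → ℕ) (h : ∑ i, k i = m) {θ θ' : P.obj n}
    {φ φ' : ∀ i, P.obj (k i)} (hθ : θ - θ' ∈ I.carrier n)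
    (hφ : ∀ i, φ i - φ' i ∈ I.carrier (k i)) :
    P.comp k h θ φ - P.comp k h θ' φ' ∈ I.carrier m := by
  have h1 : P.comp k h θ φ - P.comp k h θ' φ ∈ I.carrier m := by
    have := I.comp_mem_left k h φ hθ
    simpa using this
  have h2 : P.comp k h θ' φ - P.comp k h θ' φ' ∈ I.carrier m := by
    have := (P.comp k h θ').map_piecewise_sub_map_piecewise φ φ' φ Finset.univ
    rw [Finset.piecewise_univ, Finset.piecewise_univ] at this
    rw [this]
    refine Submodule.sum_mem _ fun i _ => I.comp_mem_right k h θ' i ?_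
    simpa using hφ i
  simpa using add_mem h1 h2

/-- The action induced on the quotient. -/
def quotAct {n : ℕ} (σ : Perm (Fin n)) :
    (P.obj n ⧸ I.carrier n) →ₗ[𝕜] (P.obj n ⧸ I.carrier n) :=
  (I.carrier n).mapQ (I.carrier n) (P.act σ) fun _ hθ => I.act_mem σ hθ

theorem quotAct_mk {n : ℕ} (σ : Perm (Fin n)) (θ : P.obj n) :
    I.quotAct σ (Submodule.Quotient.mk θ) = Submodule.Quotient.mk (P.act σ θ) := rfl

/-- Composition in the quotient, through representatives. -/
noncomputable def quotComp {n m : ℕ} (k : Fin n → ℕ) (h : ∑ i, k i = m)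
    (x : P.obj n ⧸ I.carrier n) (y : ∀ i, P.obj (k i) ⧸ I.carrier (k i)) :
    P.obj m ⧸ I.carrier m :=
  Submodule.Quotient.mk (P.comp k h (Quotient.out x) fun i => Quotient.out (y i))

theorem quotComp_mk {n m : ℕ} (k : Fin n → ℕ) (h : ∑ i, k i = m) (θ : P.obj n)
    (φ : ∀ i, P.obj (k i)) :
    I.quotComp k h (Submodule.Quotient.mk θ) (fun i => Submodule.Quotient.mk (φ i)) =
      Submodule.Quotient.mk (P.comp k h θ φ) := by
  rw [quotComp, Submodule.Quotient.eq]
  refine I.comp_sub_mem k h ?_ fun i => ?_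
  · rw [← Submodule.Quotient.eq]; exact Quotient.out_eq _
  · rw [← Submodule.Quotient.eq]; exact Quotient.out_eq _

theorem exists_reps {n : ℕ} {k : Fin n → ℕ} (y : ∀ i, P.obj (k i) ⧸ I.carrier (k i)) :
    ∃ φ : ∀ i, P.obj (k i), y = fun i => Submodule.Quotient.mk (φ i) :=
  ⟨fun i => Quotient.out (y i), funext fun i => (Quotient.out_eq (y i)).symm⟩

theorem update_mk {n : ℕ} {k : Fin n → ℕ} [DecidableEq (Fin n)] (φ : ∀ i, P.obj (k i))
    (i : Fin n) (a : P.obj (k i)) :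
    Function.update (fun i => (Submodule.Quotient.mk (φ i) : P.obj (k i) ⧸ I.carrier (k i))) i
      (Submodule.Quotient.mk a) = fun j => Submodule.Quotient.mk (Function.update φ i a j) := by
  funext j
  by_cases hj : j = i
  · subst hj; simp
  · simp [Function.update_of_ne hj]

theorem quotComp_assoc {n m t : ℕ} {k : Fin n → ℕ} (hk : ∑ i, k i = m)
    {l : ∀ i, Fin (k i) → ℕ} {s : Fin n → ℕ} (hl : ∀ i, ∑ j, l i j = s i) (hs : ∑ i, s i = t)
    (x : P.obj n ⧸ I.carrier n) (y : ∀ i, P.obj (k i) ⧸ I.carrier (k i))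
    (z : ∀ i j, P.obj (l i j) ⧸ I.carrier (l i j)) :
    I.quotComp s hs x (fun i => I.quotComp (l i) (hl i) (y i) (z i)) =
      I.quotComp (fun p : Fin m => l ((blockEquiv k hk).symm p).1 ((blockEquiv k hk).symm p).2)
        (block_sum hk l hl hs) (I.quotComp k hk x y)
        (fun p => z ((blockEquiv k hk).symm p).1 ((blockEquiv k hk).symm p).2) := by
  obtain ⟨θ, rfl⟩ := Submodule.Quotient.mk_surjective _ x
  obtain ⟨φ, rfl⟩ := I.exists_reps y
  obtain ⟨ψ, rfl⟩ : ∃ ψ : ∀ i j, P.obj (l i j),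
      z = fun i j => Submodule.Quotient.mk (ψ i j) :=
    ⟨fun i j => Quotient.out (z i j),
      funext fun i => funext fun j => (Quotient.out_eq (z i j)).symm⟩
  have e1 : (fun i => I.quotComp (l i) (hl i) (Submodule.Quotient.mk (φ i))
      (fun j => Submodule.Quotient.mk (ψ i j))) =
      fun i => Submodule.Quotient.mk (P.comp (l i) (hl i) (φ i) (ψ i)) :=
    funext fun i => I.quotComp_mk _ _ _ _
  rw [e1, quotComp_mk, quotComp_mk, P.assoc hk hl hs]
  exact (I.quotComp_mk _ (block_sum hk l hl hs) _
    (fun p => ψ ((blockEquiv k hk).symm p).1 ((blockEquiv k hk).symm p).2)).symm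

theorem quotComp_equivariance {n m : ℕ} {k : Fin n → ℕ} (hk : ∑ i, k i = m)
    (σ : Perm (Fin n)) (τ : ∀ i, Perm (Fin (k i))) (x : P.obj n ⧸ I.carrier n)
    (y : ∀ i, P.obj (k i) ⧸ I.carrier (k i)) :
    I.quotComp k hk (I.quotAct σ x) (fun i => I.quotAct (τ i) (y i)) =
      I.quotAct (blockPerm k hk σ τ)
        (I.quotComp (fun i => k (σ.symm i)) ((Equiv.sum_comp σ.symm k).trans hk) x
          (fun i => y (σ.symm i))) := by
  obtain ⟨θ, rfl⟩ := Submodule.Quotient.mk_surjective _ x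
  obtain ⟨φ, rfl⟩ := I.exists_reps y
  have e1 : (fun i => I.quotAct (τ i) (Submodule.Quotient.mk (φ i))) =
      fun i => Submodule.Quotient.mk (P.act (τ i) (φ i)) :=
    funext fun i => I.quotAct_mk _ _
  rw [e1, quotAct_mk, quotComp_mk, P.equivariance]
  exact (congrArg (I.quotAct (blockPerm k hk σ τ))
    (I.quotComp_mk (fun i => k (σ.symm i)) ((Equiv.sum_comp σ.symm k).trans hk) θ
      (fun i => φ (σ.symm i)))).symm

/-- The quotient operad `P / I`: its `n`-ary operations are `P(n) / I(n)`, with the induced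
action, identity and composition. -/
noncomputable def quotient : SymmOperad.{u, v} 𝕜 where
  obj n := P.obj n ⧸ I.carrier n
  act σ := I.quotAct σ
  one := Submodule.Quotient.mk P.one
  comp {n m} k h :=
    { toFun := fun x =>
        { toFun := fun y => I.quotComp k h x y
          map_update_add' := by
            intro _ y i a b
            obtain ⟨θ, rfl⟩ := Submodule.Quotient.mk_surjective _ x
            obtain ⟨φ, rfl⟩ := I.exists_reps y
            obtain ⟨a, rfl⟩ := Submodule.Quotient.mk_surjective _ a
            obtain ⟨b, rfl⟩ := Submodule.Quotient.mk_surjective _ b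
            rw [← Submodule.Quotient.mk_add]
            simp only [update_mk, quotComp_mk]
            rw [MultilinearMap.map_update_add, Submodule.Quotient.mk_add]
          map_update_smul' := by
            intro _ y i c a
            obtain ⟨θ, rfl⟩ := Submodule.Quotient.mk_surjective _ x
            obtain ⟨φ, rfl⟩ := I.exists_reps y
            obtain ⟨a, rfl⟩ := Submodule.Quotient.mk_surjective _ a
            rw [← Submodule.Quotient.mk_smul]
            simp only [update_mk, quotComp_mk]
            rw [MultilinearMap.map_update_smul, Submodule.Quotient.mk_smul] }
      map_add' := by
        intro x x'
        ext y
        obtain ⟨θ, rfl⟩ := Submodule.Quotient.mk_surjective _ x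
        obtain ⟨θ', rfl⟩ := Submodule.Quotient.mk_surjective _ x'
        obtain ⟨φ, rfl⟩ := I.exists_reps y
        change I.quotComp k h (Submodule.Quotient.mk (θ + θ')) _ =
          I.quotComp k h (Submodule.Quotient.mk θ) _ + I.quotComp k h (Submodule.Quotient.mk θ') _
        rw [quotComp_mk, quotComp_mk, quotComp_mk, map_add, add_apply,
          Submodule.Quotient.mk_add]
      map_smul' := by
        intro c x
        ext y
        obtain ⟨θ, rfl⟩ := Submodule.Quotient.mk_surjective _ x
        obtain ⟨φ, rfl⟩ := I.exists_reps y
        change I.quotComp k h (Submodule.Quotient.mk (c • θ)) _ =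
          c • I.quotComp k h (Submodule.Quotient.mk θ) _
        rw [quotComp_mk, quotComp_mk, map_smul, smul_apply, Submodule.Quotient.mk_smul] }
  act_one x := by
    obtain ⟨θ, rfl⟩ := Submodule.Quotient.mk_surjective _ x
    rw [quotAct_mk, P.act_one]
  act_mul σ τ x := by
    obtain ⟨θ, rfl⟩ := Submodule.Quotient.mk_surjective _ x
    rw [quotAct_mk, quotAct_mk, quotAct_mk, P.act_mul]
  comp_one {n} h x := by
    obtain ⟨θ, rfl⟩ := Submodule.Quotient.mk_surjective _ x
    exact (I.quotComp_mk _ h θ fun _ => P.one).trans (by rw [P.comp_one])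
  one_comp {n} h x := by
    obtain ⟨θ, rfl⟩ := Submodule.Quotient.mk_surjective _ x
    exact (I.quotComp_mk _ h P.one fun _ => θ).trans (by rw [P.one_comp])
  assoc hk _ _ hl hs x y z := I.quotComp_assoc hk hl hs x y z
  equivariance hk σ τ x y := I.quotComp_equivariance hk σ τ x y

end OperadicIdeal

/-! ### Truncations and Gelfand-Kirillov dimension -/

/-- `e ∈ P(0)` is a `0`-unit: a basis element of `P(0)`. An operad with a `0`-unit is unitary. -/
def IsZeroUnit (P : SymmOperad.{u, v} 𝕜) (e : P.obj 0) : Prop :=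
  e ≠ 0 ∧ ∀ x : P.obj 0, ∃ c : 𝕜, x = c • e

/-- The elements `1_0 = e ∈ P(0)` (for `false`) and `1_1 ∈ P(1)` (for `true`). -/
def unitElem (P : SymmOperad.{u, v} 𝕜) (e : P.obj 0) : ∀ b : Bool, P.obj b.toNat
  | false => e
  | true => P.one

theorem sum_indicator {n : ℕ} (I : Finset (Fin n)) :
    ∑ i, (decide (i ∈ I)).toNat = I.card := by
  simp [Bool.toNat, Bool.cond_decide]

/-- The restriction operator `π^I : P(n) → P(|I|)`, `π^I(θ) = θ ∘ (1_{χ_I(1)}, …, 1_{χ_I(n)})`,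
of the unitary operad `P` with `0`-unit `e`. -/
def restrict (P : SymmOperad.{u, v} 𝕜) (e : P.obj 0) {n : ℕ} (I : Finset (Fin n)) :
    P.obj n →ₗ[𝕜] P.obj I.card :=
  evalLinear (P.comp (fun i => (decide (i ∈ I)).toNat) (sum_indicator I))
    (fun i => P.unitElem e (decide (i ∈ I)))

/-- The `n`-ary part of the `k`-th truncation of the unitary operad `P` with `0`-unit `e`:
everything for `k = 0`; for `k ≥ 1` it is the intersection of the kernels of the `π^I` with
`|I| = k - 1` if `n ≥ k`, and `0` if `n < k`. -/
def truncation (P : SymmOperad.{u, v} 𝕜) (e : P.obj 0) : ℕ → ∀ n : ℕ, Submodule 𝕜 (P.obj n)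
  | 0, _ => ⊤
  | k + 1, n =>
    if k + 1 ≤ n then ⨅ (I : Finset (Fin n)) (_ : I.card = k), LinearMap.ker (P.restrict e I)
    else ⊥

/-- The Gelfand-Kirillov dimension `limsup_n log_n (∑_{i ≤ n} dim P(i))`. -/
noncomputable def gkdim (P : SymmOperad.{u, v} 𝕜) : EReal :=
  Filter.limsup (fun n : ℕ =>
    ENNReal.log (∑ i ∈ Finset.range (n + 1),
      (((Cardinal.toENat (Module.rank 𝕜 (P.obj i)) : ℕ∞)) : ENNReal)) / ((Real.log n : ℝ) : EReal))
    Filter.atTop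

/-! ### The operads `Com` and `As` -/

/-- The operad of unital commutative associative algebras: `Com(n) = 𝕜` for all `n`. -/
def Com (𝕜 : Type u) [Field 𝕜] : SymmOperad.{u, u} 𝕜 where
  obj _ := 𝕜
  act _ := LinearMap.id
  one := 1
  comp {n m} k _ :=
    LinearMap.toSpanSingleton 𝕜 (MultilinearMap 𝕜 (fun _ : Fin n => 𝕜) 𝕜)
      (MultilinearMap.mkPiAlgebra 𝕜 (Fin n) 𝕜)
  act_one _ := rfl
  act_mul _ _ _ := rfl
  comp_one _ θ := by simp
  one_comp _ θ := by simp
  assoc {n m t k} hk {l s} hl hs θ φ ψ := by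
    simp only [LinearMap.toSpanSingleton_apply, smul_apply,
      MultilinearMap.mkPiAlgebra_apply, smul_eq_mul]
    rw [Equiv.prod_comp (blockEquiv k hk).symm (fun x : Σ i, Fin (k i) => ψ x.1 x.2),
      Fintype.prod_sigma, Finset.prod_mul_distrib, mul_assoc]
  equivariance {n m k} hk σ τ θ φ := by
    simp [Equiv.prod_comp σ.symm φ]

theorem multilinear_ext_single {ι : Type*} [Finite ι] {X : ι → Type*} {N : Type*}
    [AddCommGroup N] [Module 𝕜 N] {f g : MultilinearMap 𝕜 (fun i => X i →₀ 𝕜) N}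
    (h : ∀ v : ∀ i, X i, f (fun i => Finsupp.single (v i) 1) =
      g (fun i => Finsupp.single (v i) 1)) : f = g :=
  Module.Basis.ext_multilinear (fun i => Finsupp.basisSingleOne (ι := X i)) fun v => by
    simpa using h v

/-- The composition of `As`: the multilinear extension of `ϑ` from permutations to `𝕜 S_n`. -/
noncomputable def asComp (𝕜 : Type u) [Field 𝕜] {n m : ℕ} (k : Fin n → ℕ) (h : ∑ i, k i = m) :
    (Perm (Fin n) →₀ 𝕜) →ₗ[𝕜]
      MultilinearMap 𝕜 (fun i => Perm (Fin (k i)) →₀ 𝕜) (Perm (Fin m) →₀ 𝕜) :=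
  Finsupp.linearCombination 𝕜 fun σ => ∑ τ : ∀ i, Perm (Fin (k i)),
    ((MultilinearMap.mkPiAlgebra 𝕜 (Fin n) 𝕜).compLinearMap
      fun i => Finsupp.lapply (τ i)).smulRight (Finsupp.single (blockPerm k h σ τ) 1)

theorem asComp_single {n m : ℕ} (k : Fin n → ℕ) (h : ∑ i, k i = m) (σ : Perm (Fin n))
    (τ : ∀ i, Perm (Fin (k i))) :
    asComp 𝕜 k h (Finsupp.single σ 1) (fun i => Finsupp.single (τ i) 1) =
      Finsupp.single (blockPerm k h σ τ) 1 := by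
  classical
  simp only [asComp, Finsupp.linearCombination_single, one_smul, sum_apply,
    MultilinearMap.smulRight_apply, MultilinearMap.compLinearMap_apply,
    MultilinearMap.mkPiAlgebra_apply, Finsupp.lapply_apply]
  rw [Finset.sum_eq_single τ]
  · simp
  · intro τ' _ hne
    obtain ⟨i, hi⟩ := Function.ne_iff.1 hne
    rw [Finset.prod_eq_zero (Finset.mem_univ i), zero_smul]
    exact Finsupp.single_eq_of_ne hi
  · simp

theorem asComp_assoc {n m t : ℕ} {k : Fin n → ℕ} (hk : ∑ i, k i = m) {l : ∀ i, Fin (k i) → ℕ}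
    {s : Fin n → ℕ} (hl : ∀ i, ∑ j, l i j = s i) (hs : ∑ i, s i = t)
    (θ : Perm (Fin n) →₀ 𝕜) (φ : ∀ i, Perm (Fin (k i)) →₀ 𝕜)
    (ψ : ∀ i j, Perm (Fin (l i j)) →₀ 𝕜) :
    asComp 𝕜 s hs θ (fun i => asComp 𝕜 (l i) (hl i) (φ i) (ψ i)) =
      asComp 𝕜 (fun p : Fin m => l ((blockEquiv k hk).symm p).1 ((blockEquiv k hk).symm p).2)
        (block_sum hk l hl hs) (asComp 𝕜 k hk θ φ)
        (fun p => ψ ((blockEquiv k hk).symm p).1 ((blockEquiv k hk).symm p).2) := by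
  classical
  let l' : Fin m → ℕ := fun p => l ((blockEquiv k hk).symm p).1 ((blockEquiv k hk).symm p).2
  -- linear in `θ`
  have hθ : (evalLinear (asComp 𝕜 s hs) fun i => asComp 𝕜 (l i) (hl i) (φ i) (ψ i)) =
      (evalLinear (asComp 𝕜 l' (block_sum hk l hl hs))
        (fun p => ψ ((blockEquiv k hk).symm p).1 ((blockEquiv k hk).symm p).2)).comp
        (evalLinear (asComp 𝕜 k hk) φ) := by
    refine Finsupp.lhom_ext' fun σ => LinearMap.ext_ring ?_
    change asComp 𝕜 s hs (Finsupp.single σ 1) (fun i => asComp 𝕜 (l i) (hl i) (φ i) (ψ i)) =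
      asComp 𝕜 l' (block_sum hk l hl hs) (asComp 𝕜 k hk (Finsupp.single σ 1) φ)
        (fun p => ψ ((blockEquiv k hk).symm p).1 ((blockEquiv k hk).symm p).2)
    -- multilinear in `φ`
    have hφ : (asComp 𝕜 s hs (Finsupp.single σ 1)).compLinearMap
          (fun i => evalLinear (asComp 𝕜 (l i) (hl i)) (ψ i)) =
        (evalLinear (asComp 𝕜 l' (block_sum hk l hl hs))
          (fun p => ψ ((blockEquiv k hk).symm p).1
            ((blockEquiv k hk).symm p).2)).compMultilinearMap
          (asComp 𝕜 k hk (Finsupp.single σ 1)) := by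
      refine multilinear_ext_single fun τ => ?_
      change asComp 𝕜 s hs (Finsupp.single σ 1)
          (fun i => asComp 𝕜 (l i) (hl i) (Finsupp.single (τ i) 1) (ψ i)) =
        asComp 𝕜 l' (block_sum hk l hl hs)
          (asComp 𝕜 k hk (Finsupp.single σ 1) fun i => Finsupp.single (τ i) 1)
          (fun p => ψ ((blockEquiv k hk).symm p).1 ((blockEquiv k hk).symm p).2)
      rw [asComp_single]
      -- multilinear in `ψ`
      let R : MultilinearMap 𝕜 (fun x : Σ i, Fin (k i) => Perm (Fin (l x.1 x.2)) →₀ 𝕜)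
          (Perm (Fin t) →₀ 𝕜) :=
        { toFun := fun z => asComp 𝕜 l' (block_sum hk l hl hs)
            (Finsupp.single (blockPerm k hk σ τ) 1) (fun p => z ((blockEquiv k hk).symm p))
          map_update_add' := by
            intro dec z x a b
            obtain ⟨p, rfl⟩ := (blockEquiv k hk).symm.surjective x
            have e := fun c => Function.update_comp_eq_of_injective' z
              (blockEquiv k hk).symm.injective p c
            simp only [e]
            exact MultilinearMap.map_update_add _ _ _ _ _
          map_update_smul' := by
            intro dec z x c a
            obtain ⟨p, rfl⟩ := (blockEquiv k hk).symm.surjective x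
            have e := fun c => Function.update_comp_eq_of_injective' z
              (blockEquiv k hk).symm.injective p c
            simp only [e]
            exact MultilinearMap.map_update_smul _ _ _ _ _ }
      have hψ : (asComp 𝕜 s hs (Finsupp.single σ 1)).compMultilinearMap
            (fun i => asComp 𝕜 (l i) (hl i) (Finsupp.single (τ i) 1)) = R := by
        refine multilinear_ext_single fun ρ => ?_
        change asComp 𝕜 s hs (Finsupp.single σ 1) (fun i => asComp 𝕜 (l i) (hl i)
            (Finsupp.single (τ i) 1) (fun j => Finsupp.single (ρ ⟨i, j⟩) 1)) =
          asComp 𝕜 l' (block_sum hk l hl hs) (Finsupp.single (blockPerm k hk σ τ) 1)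
            (fun p => Finsupp.single (ρ ((blockEquiv k hk).symm p)) 1)
        simp only [asComp_single]
        rw [blockPerm_assoc hk l hl hs (block_sum hk l hl hs) σ τ fun i j => ρ ⟨i, j⟩]
      exact congrArg (fun f => f fun x => ψ x.1 x.2) hψ
    exact congrArg (fun f => f φ) hφ
  exact congrArg (fun f => f θ) hθ

theorem asComp_equivariance {n m : ℕ} {k : Fin n → ℕ} (hk : ∑ i, k i = m)
    (σ : Perm (Fin n)) (τ : ∀ i, Perm (Fin (k i))) (θ : Perm (Fin n) →₀ 𝕜)
    (φ : ∀ i, Perm (Fin (k i)) →₀ 𝕜) :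
    asComp 𝕜 k hk (Finsupp.lmapDomain 𝕜 𝕜 (· * σ) θ)
        (fun i => Finsupp.lmapDomain 𝕜 𝕜 (· * τ i) (φ i)) =
      Finsupp.lmapDomain 𝕜 𝕜 (· * blockPerm k hk σ τ)
        (asComp 𝕜 (fun i => k (σ.symm i)) ((Equiv.sum_comp σ.symm k).trans hk) θ
          (fun i => φ (σ.symm i))) := by
  classical
  let R : (Perm (Fin n) →₀ 𝕜) → MultilinearMap 𝕜 (fun i => Perm (Fin (k i)) →₀ 𝕜)
      (Perm (Fin m) →₀ 𝕜) := fun θ =>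
    { toFun := fun z => asComp 𝕜 (fun i => k (σ.symm i))
        ((Equiv.sum_comp σ.symm k).trans hk) θ (fun i => z (σ.symm i))
      map_update_add' := by
        intro dec z x a b
        obtain ⟨p, rfl⟩ := σ.symm.surjective x
        have e := fun c => Function.update_comp_eq_of_injective' z σ.symm.injective p c
        simp only [e]
        exact MultilinearMap.map_update_add _ _ _ _ _
      map_update_smul' := by
        intro dec z x c a
        obtain ⟨p, rfl⟩ := σ.symm.surjective x
        have e := fun c => Function.update_comp_eq_of_injective' z σ.symm.injective p c
        simp only [e]
        exact MultilinearMap.map_update_smul _ _ _ _ _ }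
  have hθ : (evalLinear (asComp 𝕜 k hk)
        fun i => Finsupp.lmapDomain 𝕜 𝕜 (· * τ i) (φ i)).comp
          (Finsupp.lmapDomain 𝕜 𝕜 (· * σ)) =
      (Finsupp.lmapDomain 𝕜 𝕜 (· * blockPerm k hk σ τ)).comp
        (evalLinear (asComp 𝕜 (fun i => k (σ.symm i)) ((Equiv.sum_comp σ.symm k).trans hk))
          (fun i => φ (σ.symm i))) := by
    refine Finsupp.lhom_ext' fun ρ => LinearMap.ext_ring ?_
    have hφ : (asComp 𝕜 k hk
          (Finsupp.lmapDomain 𝕜 𝕜 (· * σ) (Finsupp.single ρ 1))).compLinearMap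
          (fun i => Finsupp.lmapDomain 𝕜 𝕜 (· * τ i)) =
        (Finsupp.lmapDomain 𝕜 𝕜 (· * blockPerm k hk σ τ)).compMultilinearMap
          (R (Finsupp.single ρ 1)) := by
      refine multilinear_ext_single fun ρ' => ?_
      change asComp 𝕜 k hk (Finsupp.lmapDomain 𝕜 𝕜 (· * σ) (Finsupp.single ρ 1))
          (fun i => Finsupp.lmapDomain 𝕜 𝕜 (· * τ i) (Finsupp.single (ρ' i) 1)) =
        Finsupp.lmapDomain 𝕜 𝕜 (· * blockPerm k hk σ τ)
          (asComp 𝕜 (fun i => k (σ.symm i)) ((Equiv.sum_comp σ.symm k).trans hk)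
            (Finsupp.single ρ 1) (fun i => Finsupp.single (ρ' (σ.symm i)) 1))
      simp only [Finsupp.lmapDomain_apply, Finsupp.mapDomain_single]
      rw [asComp_single, asComp_single (fun i => k (σ.symm i)), Finsupp.mapDomain_single,
        blockPerm_mul k hk (fun σ => (Equiv.sum_comp σ.symm k).trans hk)]
    exact congrArg (fun f => f φ) hφ
  exact congrArg (fun f => f θ) hθ

/-- The operad of unital associative algebras: `As(n) = 𝕜 S_n`, the free module on `S_n`, with
the right regular action and with composition
`σ ∘ (σ 1, …, σ n) = ϑ(σ; σ 1, …, σ n)` on permutations. -/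
noncomputable def As (𝕜 : Type u) [Field 𝕜] : SymmOperad.{u, u} 𝕜 where
  obj n := Perm (Fin n) →₀ 𝕜
  act σ := Finsupp.lmapDomain 𝕜 𝕜 (· * σ)
  one := Finsupp.single 1 1
  comp k h := asComp 𝕜 k h
  act_one θ := by
    simp only [Finsupp.lmapDomain_apply, mul_one]
    exact Finsupp.mapDomain_id
  act_mul σ τ θ := by
    simp only [Finsupp.lmapDomain_apply, ← Finsupp.mapDomain_comp]
    congr 1
  comp_one {n} h θ := by
    have : (evalLinear (asComp 𝕜 (fun _ : Fin n => 1) h)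
        fun _ => (Finsupp.single 1 1 : Perm (Fin 1) →₀ 𝕜)) = LinearMap.id := by
      refine Finsupp.lhom_ext' fun σ => LinearMap.ext_ring ?_
      change asComp 𝕜 _ h (Finsupp.single σ 1) (fun _ => Finsupp.single 1 1) =
        Finsupp.single σ 1
      rw [asComp_single, blockPerm_one_right]
    exact congrArg (fun f => f θ) this
  one_comp {n} h θ := by
    have : ∀ x : Fin 1 → (Perm (Fin n) →₀ 𝕜),
        asComp 𝕜 (fun _ : Fin 1 => n) h (Finsupp.single 1 1) x = x 0 := by
      intro x
      have : asComp 𝕜 (fun _ : Fin 1 => n) h (Finsupp.single 1 1) =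
          MultilinearMap.ofSubsingleton 𝕜 _ _ 0 LinearMap.id := by
        refine multilinear_ext_single fun v => ?_
        have hv : v = fun _ => v 0 := funext fun i => by rw [Subsingleton.elim i 0]
        rw [hv, asComp_single, blockPerm_one_left]
        simp
      rw [this]; simp
    exact this _
  assoc hk _ _ hl hs θ φ ψ := asComp_assoc hk hl hs θ φ ψ
  equivariance hk σ τ θ φ := asComp_equivariance hk σ τ θ φ

/-- The `0`-unit `1_0 ∈ As(0)`. -/
noncomputable def asZeroUnit (𝕜 : Type u) [Field 𝕜] : (As 𝕜).obj 0 :=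
  (Finsupp.single 1 1 : Perm (Fin 0) →₀ 𝕜)

theorem isZeroUnit_asZeroUnit (𝕜 : Type u) [Field 𝕜] :
    (As 𝕜).IsZeroUnit (asZeroUnit 𝕜) := by
  refine ⟨?_, fun x => ?_⟩
  · intro h
    have h' : (Finsupp.single 1 1 : Perm (Fin 0) →₀ 𝕜) = 0 := h
    simp at h'
  · let y : Perm (Fin 0) →₀ 𝕜 := x
    refine ⟨y 1, ?_⟩
    change y = y 1 • (Finsupp.single 1 1 : Perm (Fin 0) →₀ 𝕜)
    refine Finsupp.ext fun σ => ?_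
    rw [Subsingleton.elim σ 1]
    simp

end SymmOperad

/-! Call an element of `𝕜 S_n` proper if deleting any single letter kills it. The growth of the
quotient by an ideal `I` is governed by the proper elements that `I` misses. If `I` misses one of
degree `j`, then its insertions on the `j`-subsets of the letters are independent modulo `I`, so the
`n`-ary part of the quotient has dimension at least `n.choose j` (`choose_le_finrank`). If `I`
contains all proper elements of degree above `q`, then membership in `I` is decided by patterns of
length `q` (`mem_part_of_pattern_mem`), and the dimension is at most a constant times `n.choose q`
(`finrank_quotientPart_le`). So the GK dimension is one more than the largest degree of a missed
proper element. There are no nonzero proper elements of degree 1, whence the gap between 1 and 3.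

If in addition `I` vanishes in arity `q`, it is the truncation of index `q + 1`
(`carrier_eq_truncation`). This vanishing is proved arity by arity: if `I` is zero in arity `n`, all
its elements of arity `n + 1` are proper (`part_succ_eq_bot`). Proper elements of degree 2 are
multiples of the commutator; those of degree 3 are spanned by the renamings of `[[x₁, x₂], x₃]` and
form an irreducible representation when `3 ≠ 0` (`properElements_three_le_of_mem`). Hence a nonzero
element of `I` in arity at most `q` would force all proper elements of degree `q` into `I`, and the
dimension would drop.

In dimension 5 there is room for different ideals: the multilinear identities of two algebras of
triangular `5 × 5` matrices. Both contain the proper elements of degree at least 5 and miss `[[[x₁,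
x₂], x₃], x₄]`, but only the smaller algebra satisfies `[x₁, x₂] [x₃, x₄] = 0`, so the dimensions in
arity 4 differ. -/

/-! ### Relative orders and patterns of permutations -/

/-- The permutation of `Fin k` with the same relative order as the sequence `u`. -/
def standardize {α : Type*} [LinearOrder α] {k : ℕ} (u : Fin k → α) : Perm (Fin k) :=
  (Tuple.sort u).symm

theorem standardize_lt {α : Type*} [LinearOrder α] {k : ℕ} {u : Fin k → α}
    (hu : Function.Injective u) (a b : Fin k) :
    standardize u a < standardize u b ↔ u a < u b := by
  have hm : StrictMono (u ∘ Tuple.sort u) :=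
    (Tuple.monotone_sort u).strictMono_of_injective (hu.comp (Tuple.sort u).injective)
  have := hm.lt_iff_lt (a := standardize u a) (b := standardize u b)
  simpa [standardize] using this.symm

/-- The relative order that a permutation induces on the elements of a set. -/
def orderOn {n : ℕ} (S : Set (Fin n)) (σ : Perm (Fin n)) : Fin n → Fin n → Prop :=
  fun a b => a ∈ S ∧ b ∈ S ∧ σ a < σ b

theorem orderOn_eq_iff {n : ℕ} {S : Set (Fin n)} {σ τ : Perm (Fin n)} :
    orderOn S σ = orderOn S τ ↔ ∀ a ∈ S, ∀ b ∈ S, (σ a < σ b ↔ τ a < τ b) := by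
  constructor
  · intro h a ha b hb
    have := congrFun (congrFun h a) b
    simpa [orderOn, ha, hb] using this
  · intro h
    funext a b
    simp only [orderOn, eq_iff_iff]
    constructor
    · rintro ⟨ha, hb, hab⟩
      exact ⟨ha, hb, (h a ha b hb).1 hab⟩
    · rintro ⟨ha, hb, hab⟩
      exact ⟨ha, hb, (h a ha b hb).2 hab⟩

/-- The pattern of a permutation `σ` along `f`: the relative order of the values `σ (f a)`. -/
def pattern {n k : ℕ} (f : Fin k → Fin n) (σ : Perm (Fin n)) : Perm (Fin k) :=
  standardize (σ ∘ f)

theorem pattern_lt {n k : ℕ} {f : Fin k → Fin n} (hf : Function.Injective f)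
    (σ : Perm (Fin n)) (a b : Fin k) :
    pattern f σ a < pattern f σ b ↔ σ (f a) < σ (f b) :=
  standardize_lt (σ.injective.comp hf) a b

theorem pattern_eq_iff {n k : ℕ} {f : Fin k → Fin n} (hf : Function.Injective f)
    {σ : Perm (Fin n)} {τ : Perm (Fin k)} :
    pattern f σ = τ ↔ ∀ a b, (σ (f a) < σ (f b) ↔ τ a < τ b) := by
  constructor
  · rintro rfl a b
    exact (pattern_lt hf σ a b).symm
  · intro h
    exact equiv_fin_ext _ _ fun a b => (pattern_lt hf σ a b).trans (h a b)

/-- `pattern f` and `orderOn (Set.range f)` have the same fibres, so their linearizations have the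
same kernel. This is the passage between subsets of letters and order embeddings. -/
theorem pattern_eq_pattern_iff {n k : ℕ} {f : Fin k → Fin n} (hf : Function.Injective f)
    {σ τ : Perm (Fin n)} :
    pattern f σ = pattern f τ ↔ orderOn (Set.range f) σ = orderOn (Set.range f) τ := by
  rw [pattern_eq_iff hf, orderOn_eq_iff]
  simp [pattern_lt hf]

theorem pattern_id {n : ℕ} : pattern (id : Fin n → Fin n) = id := by
  funext σ
  exact (pattern_eq_iff Function.injective_id).2 fun a b => Iff.rfl

theorem pattern_comp {n k l : ℕ} {f : Fin k → Fin n} {g : Fin l → Fin k}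
    (hf : Function.Injective f) (hg : Function.Injective g) (σ : Perm (Fin n)) :
    pattern g (pattern f σ) = pattern (f ∘ g) σ := by
  symm
  rw [pattern_eq_iff (hf.comp hg)]
  intro a b
  rw [pattern_lt hg, pattern_lt hf]
  rfl

/-! ### Kernels of linearized maps -/

section lmapDomain

variable {𝕜 : Type*} [Field 𝕜] {α β γ δ : Type*}

theorem lmapDomain_comp_apply (p : α → β) (q : β → γ) (θ : α →₀ 𝕜) :
    Finsupp.lmapDomain 𝕜 𝕜 q (Finsupp.lmapDomain 𝕜 𝕜 p θ) =
      Finsupp.lmapDomain 𝕜 𝕜 (q ∘ p) θ := by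
  simp only [Finsupp.lmapDomain_apply]
  exact Finsupp.mapDomain_comp.symm

/-- The kernel of the linearization of a map decreases when the fibres get smaller. -/
theorem lmapDomain_eq_zero_of_fibers {p : α → β} {q : α → γ}
    (h : ∀ a b, p a = p b → q a = q b) {θ : α →₀ 𝕜}
    (hθ : Finsupp.lmapDomain 𝕜 𝕜 p θ = 0) : Finsupp.lmapDomain 𝕜 𝕜 q θ = 0 := by
  rcases isEmpty_or_nonempty α with hα | hα
  · rw [Subsingleton.elim θ 0, map_zero]
  · have hq : q = (fun b => q (Function.invFun p b)) ∘ p := by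
      funext a
      exact (h _ _ (Function.invFun_eq ⟨a, rfl⟩)).symm
    rw [hq, ← lmapDomain_comp_apply, hθ, map_zero]

/-- Used with `q` an insertion of letters or a deletion followed by one, `p` the deletion of a
letter, and `r` a relative order that does not see that letter. -/
theorem lmapDomain_lmapDomain_eq_zero {p : α → β} {q : α → γ} {r : γ → δ}
    (h : ∀ a b, p a = p b → r (q a) = r (q b)) {θ : α →₀ 𝕜}
    (hθ : Finsupp.lmapDomain 𝕜 𝕜 p θ = 0) :
    Finsupp.lmapDomain 𝕜 𝕜 r (Finsupp.lmapDomain 𝕜 𝕜 q θ) = 0 := by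
  rw [lmapDomain_comp_apply]
  exact lmapDomain_eq_zero_of_fibers h hθ

theorem lmapDomain_lmapDomain_eq_self {p : α → β} {q : β → α} (h : ∀ a, q (p a) = a)
    (θ : α →₀ 𝕜) : Finsupp.lmapDomain 𝕜 𝕜 q (Finsupp.lmapDomain 𝕜 𝕜 p θ) = θ := by
  rw [lmapDomain_comp_apply, show q ∘ p = id from funext h]
  simp

end lmapDomain

/-- The proper elements of `𝕜 S_n`: those killed by forgetting any one of the letters. -/
noncomputable def properElements (𝕜 : Type u) [Field 𝕜] (n : ℕ) :
    Submodule 𝕜 (Perm (Fin n) →₀ 𝕜) :=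
  ⨅ i : Fin n, LinearMap.ker (Finsupp.lmapDomain 𝕜 𝕜 (orderOn ({i}ᶜ : Set (Fin n))))

theorem mem_properElements {𝕜 : Type u} [Field 𝕜] {n : ℕ} {θ : Perm (Fin n) →₀ 𝕜} :
    θ ∈ properElements 𝕜 n ↔
      ∀ i : Fin n, Finsupp.lmapDomain 𝕜 𝕜 (orderOn ({i}ᶜ : Set (Fin n))) θ = 0 := by
  simp [properElements, Submodule.mem_iInf]

/-! ### Restrictions, ideals and insertions in `As` -/

namespace SymmOperad

variable {𝕜 : Type u} [Field 𝕜]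

/-- In the restriction to `K`, the `a`-th letter is the only letter of the block of the `a`-th
element of `K`. -/
theorem blockEquiv_indicator {n : ℕ} (K : Finset (Fin n)) (a : Fin K.card) :
    ((blockEquiv (fun i => (decide (i ∈ K)).toNat) (sum_indicator K)).symm a).1 =
      K.orderEmbOfFin rfl a := by
  let B := blockEquiv (fun i => (decide (i ∈ K)).toNat) (sum_indicator K)
  have hmem : ∀ x : Σ i, Fin (decide (i ∈ K)).toNat, x.1 ∈ K := by
    rintro ⟨i, c⟩
    by_contra h
    have hc := c.2
    simp [h] at hc
  have hsub : ∀ x : Σ i, Fin (decide (i ∈ K)).toNat, (x.2 : ℕ) = 0 := by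
    rintro ⟨i, c⟩
    have := c.2
    have h1 := Bool.toNat_le (decide (i ∈ K))
    change (c : ℕ) = 0
    omega
  have hmono : StrictMono fun a : Fin K.card => (B.symm a).1 := by
    intro a b hab
    have := (blockEquiv_lt _ (sum_indicator K) (B.symm a) (B.symm b)).1 (by simpa [B] using hab)
    rcases this with h | ⟨h, h'⟩
    · exact h
    · rw [hsub, hsub] at h'
      exact absurd h' (lt_irrefl _)
  -- There is only one increasing map from `Fin K.card` into `K`.
  have := Finset.orderEmbOfFin_unique (s := K) rfl (f := fun a => (B.symm a).1)
    (fun a => hmem _) hmono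
  exact congrFun this a

/-- A block of size 1 keeps its letter and a block of size 0 deletes it, so only the order of the
surviving letters under `σ` remains. -/
theorem blockPerm_indicator {n : ℕ} (K : Finset (Fin n)) (σ : Perm (Fin n)) :
    blockPerm (fun i => (decide (i ∈ K)).toNat) (sum_indicator K) σ (fun _ => 1) =
      pattern (K.orderEmbOfFin rfl) σ := by
  symm
  rw [pattern_eq_iff (K.orderEmbOfFin rfl).injective]
  intro a b
  let B := blockEquiv (fun i => (decide (i ∈ K)).toNat) (sum_indicator K)
  have h := blockPerm_lt _ (sum_indicator K) σ (fun _ => 1) (B.symm a) (B.symm b)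
  rw [show blockEquiv _ (sum_indicator K) (B.symm a) = a from B.apply_symm_apply a,
    show blockEquiv _ (sum_indicator K) (B.symm b) = b from B.apply_symm_apply b] at h
  rw [h, ← blockEquiv_indicator, ← blockEquiv_indicator]
  have hsub : ∀ x : Σ i, Fin (decide (i ∈ K)).toNat, (x.2 : ℕ) = 0 := by
    rintro ⟨i, c⟩
    have := c.2
    have h1 := Bool.toNat_le (decide (i ∈ K))
    change (c : ℕ) = 0
    omega
  simp [hsub, B]

/-- In `As`, restriction is the linearization of taking patterns. -/
theorem restrict_eq_lmapDomain {n : ℕ} (K : Finset (Fin n)) :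
    (As 𝕜).restrict (asZeroUnit 𝕜) K =
      (Finsupp.lmapDomain 𝕜 𝕜 (pattern (K.orderEmbOfFin rfl)) :
        (Perm (Fin n) →₀ 𝕜) →ₗ[𝕜] (Perm (Fin K.card) →₀ 𝕜)) := by
  refine Finsupp.lhom_ext' fun σ => LinearMap.ext_ring ?_
  have e : (fun i => (As 𝕜).unitElem (asZeroUnit 𝕜) (decide (i ∈ K))) =
      fun i => (Finsupp.single 1 1 : Perm (Fin (decide (i ∈ K)).toNat) →₀ 𝕜) := by
    funext i
    cases decide (i ∈ K) <;> rfl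
  change asComp 𝕜 _ (sum_indicator K) (Finsupp.single σ 1)
    (fun i => (As 𝕜).unitElem (asZeroUnit 𝕜) (decide (i ∈ K))) =
      Finsupp.lmapDomain 𝕜 𝕜 (pattern (K.orderEmbOfFin rfl)) (Finsupp.single σ 1)
  rw [e, asComp_single, blockPerm_indicator]
  simp

/-- The target of `orderOn` does not depend on `K.card`, so this form of the kernel condition needs
no transport along equalities of cardinals. -/
theorem restrict_eq_zero_iff {n : ℕ} (K : Finset (Fin n)) (θ : Perm (Fin n) →₀ 𝕜) :
    (As 𝕜).restrict (asZeroUnit 𝕜) K θ = 0 ↔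
      Finsupp.lmapDomain 𝕜 𝕜 (orderOn (K : Set (Fin n))) θ = 0 := by
  rw [restrict_eq_lmapDomain]
  have hr : Set.range (K.orderEmbOfFin rfl) = K := Finset.range_orderEmbOfFin _ _
  have h := fun σ τ => pattern_eq_pattern_iff (K.orderEmbOfFin rfl).injective (σ := σ) (τ := τ)
  rw [hr] at h
  exact ⟨lmapDomain_eq_zero_of_fibers fun a b => (h a b).1,
    lmapDomain_eq_zero_of_fibers fun a b => (h a b).2⟩

theorem mem_truncation_iff {k n : ℕ} (θ : Perm (Fin n) →₀ 𝕜) (hn : k + 1 ≤ n) :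
    θ ∈ ((As 𝕜).truncation (asZeroUnit 𝕜) (k + 1) n : Submodule 𝕜 (Perm (Fin n) →₀ 𝕜)) ↔
      ∀ f : Fin k ↪o Fin n, Finsupp.lmapDomain 𝕜 𝕜 (pattern f) θ = 0 := by
  have h1 : ∀ θ : (As 𝕜).obj n, θ ∈ (As 𝕜).truncation (asZeroUnit 𝕜) (k + 1) n ↔
      ∀ K : Finset (Fin n), K.card = k → (As 𝕜).restrict (asZeroUnit 𝕜) K θ = 0 := by
    intro θ
    rw [truncation, if_pos hn]
    simp only [Submodule.mem_iInf, LinearMap.mem_ker]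
  have h0 : θ ∈ ((As 𝕜).truncation (asZeroUnit 𝕜) (k + 1) n : Submodule 𝕜 (Perm (Fin n) →₀ 𝕜)) ↔
      ∀ K : Finset (Fin n), K.card = k →
        Finsupp.lmapDomain 𝕜 𝕜 (orderOn (K : Set (Fin n))) θ = 0 :=
    (h1 θ).trans (forall₂_congr fun K _ => restrict_eq_zero_iff K θ)
  rw [h0]
  constructor
  · intro h f
    refine lmapDomain_eq_zero_of_fibers (fun a b hab => ?_) (h (Finset.univ.map f.toEmbedding)
      (by simp))
    rw [pattern_eq_pattern_iff f.injective]
    simpa using hab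
  · intro h K hK
    refine lmapDomain_eq_zero_of_fibers (fun a b hab => ?_) (h (K.orderEmbOfFin hK))
    rw [pattern_eq_pattern_iff (K.orderEmbOfFin hK).injective] at hab
    simpa using hab

namespace OperadicIdeal

variable (I : (As 𝕜).OperadicIdeal)

/-- The `n`-ary part of an ideal of `As`, as a submodule of `𝕜 S_n`. -/
def part (n : ℕ) : Submodule 𝕜 (Perm (Fin n) →₀ 𝕜) := I.carrier n

theorem mul_mem_part {n : ℕ} (ρ : Perm (Fin n)) {θ : Perm (Fin n) →₀ 𝕜} (h : θ ∈ I.part n) :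
    Finsupp.lmapDomain 𝕜 𝕜 (· * ρ) θ ∈ I.part n :=
  I.act_mem ρ h

theorem asComp_mem_left {n m : ℕ} (k : Fin n → ℕ) (h : ∑ i, k i = m) {θ : Perm (Fin n) →₀ 𝕜}
    (φ : ∀ i, Perm (Fin (k i)) →₀ 𝕜) (hθ : θ ∈ I.part n) : asComp 𝕜 k h θ φ ∈ I.part m :=
  I.comp_mem_left k h φ hθ

theorem asComp_mem_right {n m : ℕ} (k : Fin n → ℕ) (h : ∑ i, k i = m) (θ : Perm (Fin n) →₀ 𝕜)
    {φ : ∀ i, Perm (Fin (k i)) →₀ 𝕜} (i : Fin n) (hi : φ i ∈ I.part (k i)) :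
    asComp 𝕜 k h θ φ ∈ I.part m :=
  I.comp_mem_right k h θ i hi

theorem pattern_mem_part {n k : ℕ} (f : Fin k ↪o Fin n) {θ : Perm (Fin n) →₀ 𝕜}
    (h : θ ∈ I.part n) : Finsupp.lmapDomain 𝕜 𝕜 (pattern f) θ ∈ I.part k := by
  obtain ⟨K, hK, rfl⟩ : ∃ (K : Finset (Fin n)) (hK : K.card = k), f = K.orderEmbOfFin hK := by
    refine ⟨Finset.univ.map f.toEmbedding, by simp, ?_⟩
    refine DFunLike.coe_injective (Finset.orderEmbOfFin_unique _ (fun x => ?_) f.strictMono)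
    simp
  subst hK
  -- Taking a pattern is composing with units on the right, which preserves the ideal.
  have := I.comp_mem_left _ (sum_indicator K)
    (fun i => (As 𝕜).unitElem (asZeroUnit 𝕜) (decide (i ∈ K))) h
  have e : (As 𝕜).restrict (asZeroUnit 𝕜) K θ ∈ I.carrier K.card := this
  rw [restrict_eq_lmapDomain] at e
  exact e

end OperadicIdeal

/-- Insertion of words: a word in the letters `f 0, …, f (k - 1)` is multiplied by the product of
the remaining letters in some fixed order. Here `k = s 0`, and `s 1` is the number of remaining
letters. -/
theorem exists_insertion_of_sum {n : ℕ} {s : Fin 2 → ℕ} (hs : ∑ i, s i = n) {f : Fin (s 0) → Fin n}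
    (hf : Function.Injective f) :
    ∃ ι : Perm (Fin (s 0)) → Perm (Fin n),
      (∀ (𝕜 : Type u) [Field 𝕜] (I : (As 𝕜).OperadicIdeal) (θ : Perm (Fin (s 0)) →₀ 𝕜),
        θ ∈ I.part (s 0) → Finsupp.lmapDomain 𝕜 𝕜 ι θ ∈ I.part n) ∧
      (∀ τ x y, ι τ (f x) < ι τ (f y) ↔ τ x < τ y) ∧
      (∀ τ x b, b ∉ Set.range f → ι τ (f x) < ι τ b) ∧
      (∀ τ τ' a b, a ∉ Set.range f → b ∉ Set.range f → (ι τ a < ι τ b ↔ ι τ' a < ι τ' b)) := by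
  -- The word `τ` goes into block 0; the remaining letters keep their order in block 1.
  let φ : Perm (Fin (s 0)) → ∀ i, Perm (Fin (s i)) := fun τ => Function.update (fun _ => 1) 0 τ
  let g : Fin (s 0) → Fin n := fun x => blockEquiv s hs ⟨0, x⟩
  have hg : Function.Injective g := by
    intro x y hxy
    have := (blockEquiv s hs).injective hxy
    simpa using this
  -- A renaming of the letters that identifies those selected by `f` with the first block; on the
  -- others it is arbitrary.
  obtain ⟨ρ, hρ⟩ : ∃ ρ : Perm (Fin n), ∀ x, ρ (f x) = g x := by
    let e : {a // a ∈ Set.range f} ≃ {a // a ∈ Set.range g} :=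
      (Equiv.ofInjective f hf).symm.trans (Equiv.ofInjective g hg)
    refine ⟨e.extendSubtype, fun x => ?_⟩
    rw [Equiv.extendSubtype_apply_of_mem e (f x) ⟨x, rfl⟩]
    change ((Equiv.ofInjective g hg) ((Equiv.ofInjective f hf).symm ⟨f x, _⟩) : Fin n) = g x
    rw [show (⟨f x, ⟨x, rfl⟩⟩ : {a // a ∈ Set.range f}) = Equiv.ofInjective f hf x from rfl,
      Equiv.symm_apply_apply]
    rfl
  have hρ' : ∀ b, b ∉ Set.range f → ∃ c, ρ b = blockEquiv s hs ⟨1, c⟩ := by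
    intro b hb
    obtain ⟨⟨i, c⟩, h⟩ := (blockEquiv s hs).surjective (ρ b)
    have hi : i = 0 ∨ i = 1 := by omega
    rcases hi with rfl | rfl
    · exact absurd ⟨c, ρ.injective ((hρ c).trans h)⟩ hb
    · exact ⟨c, h.symm⟩
  refine ⟨fun τ => blockPerm s hs 1 (φ τ) * ρ, ?_, ?_, ?_, ?_⟩
  · intro 𝕜 _ I θ hθ
    let ψ : ∀ i, Perm (Fin (s i)) →₀ 𝕜 := fun _ => Finsupp.single 1 1
    -- Insertion is composition of the product `x₁ x₂` with the word in its first slot, followed by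
    -- a renaming; both operations preserve ideals.
    let L : (Perm (Fin (s 0)) →₀ 𝕜) →ₗ[𝕜] (Perm (Fin n) →₀ 𝕜) :=
      (Finsupp.lmapDomain 𝕜 𝕜 (· * ρ)).comp
        ((asComp 𝕜 s hs (Finsupp.single 1 1)).toLinearMap ψ 0)
    have hL : L = Finsupp.lmapDomain 𝕜 𝕜 (fun τ => blockPerm s hs 1 (φ τ) * ρ) := by
      refine Finsupp.lhom_ext' fun τ => LinearMap.ext_ring ?_
      change Finsupp.lmapDomain 𝕜 𝕜 (· * ρ) (asComp 𝕜 s hs (Finsupp.single 1 1)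
        (Function.update ψ 0 (Finsupp.single τ 1))) =
          Finsupp.lmapDomain 𝕜 𝕜 (fun τ => blockPerm s hs 1 (φ τ) * ρ) (Finsupp.single τ 1)
      have h1 : Function.update ψ 0 (Finsupp.single τ 1) =
          fun i => Finsupp.single (φ τ i) 1 := by
        funext i
        by_cases hi : i = 0
        · subst hi; simp [φ]
        · simp [φ, ψ, Function.update_of_ne hi]
      rw [h1, asComp_single]
      simp
    rw [← hL]
    refine I.mul_mem_part ρ ?_
    change asComp 𝕜 s hs (Finsupp.single 1 1) (Function.update ψ 0 θ) ∈ _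
    refine I.asComp_mem_right s hs _ 0 ?_
    rwa [Function.update_self]
  · intro τ x y
    simp only [Perm.mul_apply, hρ]
    have := blockPerm_lt s hs 1 (φ τ) ⟨0, x⟩ ⟨0, y⟩
    exact this.trans (by simp [φ])
  · intro τ x b hb
    obtain ⟨c, hc⟩ := hρ' b hb
    simp only [Perm.mul_apply, hρ, hc]
    exact (blockPerm_lt s hs 1 (φ τ) ⟨0, x⟩ ⟨1, c⟩).2 (Or.inl (by simp))
  · intro τ τ' a b ha hb
    obtain ⟨c, hc⟩ := hρ' a ha
    obtain ⟨d, hd⟩ := hρ' b hb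
    simp only [Perm.mul_apply, hc, hd]
    rw [blockPerm_lt, blockPerm_lt]
    simp [φ]

/-- The selected letters precede all others, and the order of the others does not depend on `τ`. So
`ι` is a section of `pattern f`, and the order that `ι τ` induces on a set avoiding `f x` depends
only on `τ` with the letter `x` deleted. -/
theorem exists_insertion {n k : ℕ} {f : Fin k → Fin n} (hf : Function.Injective f) :
    ∃ ι : Perm (Fin k) → Perm (Fin n),
      (∀ (𝕜 : Type u) [Field 𝕜] (I : (As 𝕜).OperadicIdeal) (θ : Perm (Fin k) →₀ 𝕜),
        θ ∈ I.part k → Finsupp.lmapDomain 𝕜 𝕜 ι θ ∈ I.part n) ∧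
      (∀ τ x y, ι τ (f x) < ι τ (f y) ↔ τ x < τ y) ∧
      (∀ τ x b, b ∉ Set.range f → ι τ (f x) < ι τ b) ∧
      (∀ τ τ' a b, a ∉ Set.range f → b ∉ Set.range f → (ι τ a < ι τ b ↔ ι τ' a < ι τ' b)) := by
  have hkn : k ≤ n := by simpa using Fintype.card_le_of_injective f hf
  exact exists_insertion_of_sum (s := ![k, n - k]) (by simp [Fin.sum_univ_two]; omega) hf

end SymmOperad

/-! ### Reduction to proper elements -/

namespace SymmOperad

variable {𝕜 : Type u} [Field 𝕜]

namespace OperadicIdeal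

variable (I : (As 𝕜).OperadicIdeal)

/-- The deletions are made to vanish one letter at a time: the deletion of `i` lies in the ideal,
hence so does its reinsertion, and subtracting this does not spoil the deletions already killed. -/
theorem exists_proper_sub_mem {n : ℕ} {θ : Perm (Fin (n + 1)) →₀ 𝕜}
    (h : ∀ i : Fin (n + 1),
      Finsupp.lmapDomain 𝕜 𝕜 (pattern (Fin.succAboveOrderEmb i)) θ ∈ I.part n) :
    ∃ θ' ∈ properElements 𝕜 (n + 1), θ - θ' ∈ I.part (n + 1) := by
  suffices key : ∀ s : Finset (Fin (n + 1)), ∃ θ', θ - θ' ∈ I.part (n + 1) ∧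
      ∀ i ∈ s, Finsupp.lmapDomain 𝕜 𝕜 (orderOn ({i}ᶜ : Set (Fin (n + 1)))) θ' = 0 by
    obtain ⟨θ', h1, h2⟩ := key Finset.univ
    exact ⟨θ', mem_properElements.2 fun i => h2 i (Finset.mem_univ i), h1⟩
  intro s
  induction s using Finset.induction_on with
  | empty => exact ⟨θ, by simp, by simp⟩
  | insert i s hi ih =>
    obtain ⟨θ', h1, h2⟩ := ih
    have hf : Function.Injective (Fin.succAboveOrderEmb i) := (Fin.succAboveOrderEmb i).injective
    have hrange : Set.range (Fin.succAboveOrderEmb i) = {i}ᶜ := Fin.range_succAbove i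
    obtain ⟨ι, hI, hι1, hι2, -⟩ := exists_insertion hf
    have hsect : ∀ τ, pattern (Fin.succAboveOrderEmb i) (ι τ) = τ := fun τ =>
      (pattern_eq_iff hf).2 fun a b => hι1 τ a b
    let δ := Finsupp.lmapDomain 𝕜 𝕜 (pattern (Fin.succAboveOrderEmb i))
    have hδ : δ θ' ∈ I.part n := by
      have h3 := I.pattern_mem_part (Fin.succAboveOrderEmb i) h1
      rw [map_sub] at h3
      have h4 := sub_mem (h i) h3
      rwa [sub_sub_cancel] at h4
    -- Delete `i` and put it back at the end of every word; the difference is killed by deleting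
    -- `i`.
    refine ⟨θ' - Finsupp.lmapDomain 𝕜 𝕜 ι (δ θ'), ?_, ?_⟩
    · have := add_mem h1 (hI 𝕜 I _ hδ)
      convert this using 1
      abel
    · intro j hj
      rw [Finset.mem_insert] at hj
      by_cases hji : j = i
      · subst hji
        have h4 : δ (θ' - Finsupp.lmapDomain 𝕜 𝕜 ι (δ θ')) = 0 := by
          rw [map_sub]
          have := lmapDomain_lmapDomain_eq_self (𝕜 := 𝕜) hsect (δ θ')
          exact sub_eq_zero.2 this.symm
        refine lmapDomain_eq_zero_of_fibers (fun σ τ hστ => ?_) h4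
        rwa [pattern_eq_pattern_iff hf, hrange] at hστ
      · have hjs : j ∈ s := hj.resolve_left hji
        rw [map_sub, h2 j hjs, zero_sub, neg_eq_zero]
        change Finsupp.lmapDomain 𝕜 𝕜 (orderOn {j}ᶜ) (Finsupp.lmapDomain 𝕜 𝕜 ι
          (Finsupp.lmapDomain 𝕜 𝕜 (pattern (Fin.succAboveOrderEmb i)) θ')) = 0
        rw [lmapDomain_comp_apply]
        -- Moving `i` to the end and then deleting `j` depends only on the word with `j` deleted,
        -- and `θ'` is already killed by that deletion.
        refine lmapDomain_lmapDomain_eq_zero (fun σ τ hστ => ?_) (h2 j hjs)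
        simp only [Function.comp_apply]
        rw [orderOn_eq_iff] at hστ ⊢
        intro a ha b hb
        have hcase : ∀ c, c = i ∨ ∃ x, Fin.succAboveOrderEmb i x = c := by
          intro c
          by_cases hc : c = i
          · exact Or.inl hc
          · exact Or.inr (Fin.exists_succAbove_eq hc)
        have hi' : i ∉ Set.range (Fin.succAboveOrderEmb i) := by rw [hrange]; simp
        rcases hcase a with ha' | ⟨x, rfl⟩
        · rcases hcase b with hb' | ⟨y, rfl⟩
          · rw [ha', hb']; simp
          · rw [ha']
            exact iff_of_false (lt_asymm (hι2 _ y i hi')) (lt_asymm (hι2 _ y i hi'))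
        · rcases hcase b with hb' | ⟨y, rfl⟩
          · rw [hb']
            exact iff_of_true (hι2 _ x i hi') (hι2 _ x i hi')
          · rw [hι1, hι1, pattern_lt hf, pattern_lt hf]
            exact hστ _ ha _ hb

/-- If an ideal contains all proper elements of degree `> q`, then membership in the ideal can be
tested on the patterns of length `q`. -/
theorem mem_part_of_pattern_mem {q : ℕ}
    (hI : ∀ j, q + 1 ≤ j → properElements 𝕜 j ≤ I.part j) {n : ℕ} (hn : q ≤ n)
    {θ : Perm (Fin n) →₀ 𝕜}
    (h : ∀ f : Fin q ↪o Fin n, Finsupp.lmapDomain 𝕜 𝕜 (pattern f) θ ∈ I.part q) :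
    θ ∈ I.part n := by
  induction n, hn using Nat.le_induction with
  | base =>
    have := h (RelEmbedding.refl _)
    rw [show ⇑(RelEmbedding.refl (α := Fin q) (· ≤ ·)) = id from rfl, pattern_id] at this
    simpa using this
  | succ n hn ih =>
    -- The patterns of a deletion of `θ` are patterns of `θ`, so by induction all deletions lie in
    -- the ideal. Then `θ` is proper modulo `I`, and its degree `n + 1` exceeds `q`.
    obtain ⟨θ', h1, h2⟩ := I.exists_proper_sub_mem (θ := θ) fun i => by
      refine ih fun g => ?_
      have := h (g.trans (Fin.succAboveOrderEmb i))
      rw [lmapDomain_comp_apply]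
      convert this using 3
      funext σ
      exact pattern_comp (Fin.succAboveOrderEmb i).injective g.injective σ
    have := add_mem h2 (hI (n + 1) (by omega) h1)
    simpa using this

theorem truncation_le_part {q : ℕ}
    (hI : ∀ j, q + 1 ≤ j → properElements 𝕜 j ≤ I.part j) (n : ℕ) :
    (As 𝕜).truncation (asZeroUnit 𝕜) (q + 1) n ≤ I.carrier n := by
  by_cases hn : q + 1 ≤ n
  · intro θ hθ
    have h := (mem_truncation_iff (𝕜 := 𝕜) θ hn).1 hθ
    exact I.mem_part_of_pattern_mem hI (by omega) fun f => by rw [h f]; exact zero_mem _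
  · rw [truncation, if_neg hn]
    exact bot_le

/-- Insertion maps the `n`-ary part injectively into the `k`-ary one, with taking patterns as a left
inverse. -/
theorem part_eq_bot_of_le {n k : ℕ} (hnk : n ≤ k) (hk : I.part k = ⊥) : I.part n = ⊥ := by
  rw [Submodule.eq_bot_iff]
  intro θ hθ
  have hf := Fin.castLE_injective hnk
  obtain ⟨ι, hI, hι1, -, -⟩ := exists_insertion hf
  have h := hI 𝕜 I θ hθ
  rw [hk, Submodule.mem_bot] at h
  have hsect : ∀ τ, pattern (Fin.castLE hnk) (ι τ) = τ := fun τ =>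
    (pattern_eq_iff hf).2 fun a b => hι1 τ a b
  rw [← lmapDomain_lmapDomain_eq_self (𝕜 := 𝕜) hsect θ, h, map_zero]

/-- Patterns of length `q` of an element of `I` lie in `I.part q`, which is zero; in arities at most
`q` the ideal itself vanishes. -/
theorem part_le_truncation {q : ℕ} (hq : I.part q = ⊥) (n : ℕ) :
    I.carrier n ≤ (As 𝕜).truncation (asZeroUnit 𝕜) (q + 1) n := by
  by_cases hn : q + 1 ≤ n
  · intro θ hθ
    refine (mem_truncation_iff (𝕜 := 𝕜) θ hn).2 fun f => ?_
    have := I.pattern_mem_part f (θ := θ) hθ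
    rwa [hq] at this
  · have : I.carrier n = ⊥ := I.part_eq_bot_of_le (by omega) hq
    rw [this]
    exact bot_le

theorem carrier_eq_truncation {q : ℕ} (hq : I.part q = ⊥)
    (hI : ∀ j, q + 1 ≤ j → properElements 𝕜 j ≤ I.part j) (n : ℕ) :
    I.carrier n = (As 𝕜).truncation (asZeroUnit 𝕜) (q + 1) n :=
  le_antisymm (I.part_le_truncation hq n) (I.truncation_le_part hI n)

/-- The deletions of an element of `I.part (n + 1)` lie in `I.part n = ⊥`, so the element is proper.
-/
theorem part_succ_eq_bot {n : ℕ} (hn : I.part n = ⊥)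
    (h : ∀ θ ∈ I.part (n + 1), θ ∈ properElements 𝕜 (n + 1) → θ = 0) : I.part (n + 1) = ⊥ := by
  rw [Submodule.eq_bot_iff]
  intro θ hθ
  refine h θ hθ (mem_properElements.2 fun i => ?_)
  have h1 := I.pattern_mem_part (Fin.succAboveOrderEmb i) hθ
  rw [hn, Submodule.mem_bot] at h1
  refine lmapDomain_eq_zero_of_fibers (fun σ τ hστ => ?_) h1
  rw [pattern_eq_pattern_iff (Fin.succAboveOrderEmb i).injective] at hστ
  have hrange : Set.range (Fin.succAboveOrderEmb i) = {i}ᶜ := Fin.range_succAbove i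
  rwa [hrange] at hστ

theorem single_mem_part {n : ℕ} {σ : Perm (Fin n)} (h : Finsupp.single σ 1 ∈ I.part n) :
    I.part n = ⊤ := by
  rw [eq_top_iff, ← Finsupp.span_single_eq_top]
  rw [Submodule.span_le]
  rintro _ ⟨τ, c, rfl⟩
  have h1 := I.mul_mem_part (σ⁻¹ * τ) h
  have h2 := (I.part n).smul_mem c h1
  simpa using h2

/-- An ideal of `As` with nonzero `0`-ary part is everything. -/
theorem part_eq_top (h : I.part 0 ≠ ⊥) (n : ℕ) : I.part n = ⊤ := by
  obtain ⟨θ, hθ, h0⟩ := Submodule.exists_mem_ne_zero_of_ne_bot h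
  have h1 : θ = θ 1 • Finsupp.single 1 1 := by
    refine Finsupp.ext fun σ => ?_
    rw [Subsingleton.elim σ 1]
    simp
  have hc : θ 1 ≠ 0 := by
    intro hc
    rw [hc, zero_smul] at h1
    exact h0 h1
  have h2 : Finsupp.single (1 : Perm (Fin 0)) (1 : 𝕜) ∈ I.part 0 := by
    have := (I.part 0).smul_mem (θ 1)⁻¹ hθ
    rw [h1] at this
    simpa [hc] using this
  obtain ⟨ι, hI, -⟩ := exists_insertion (f := (Fin.elim0 : Fin 0 → Fin n))
    (fun a => a.elim0)
  have h3 := hI 𝕜 I _ h2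
  rw [Finsupp.lmapDomain_apply, Finsupp.mapDomain_single] at h3
  exact I.single_mem_part h3

/-! ### Dimensions -/

/-- The quotient of `𝕜 S_n` by the `n`-ary part of an ideal. -/
abbrev quotientPart (n : ℕ) : Type u := (Perm (Fin n) →₀ 𝕜) ⧸ I.part n

/-- Insert `γ` on the letters of each `j`-subset `K`. The pattern along `K` returns `γ`, while the
pattern along another `j`-subset forgets a letter of `K` and gives 0 because `γ` is proper. A
relation modulo `I` thus puts each coefficient times `γ` into `I`. -/
theorem choose_le_finrank {j : ℕ} {γ : Perm (Fin j) →₀ 𝕜} (hγ : γ ∈ properElements 𝕜 j)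
    (hγI : γ ∉ I.part j) (n : ℕ) : n.choose j ≤ Module.finrank 𝕜 (I.quotientPart n) := by
  let X := {K : Finset (Fin n) // K.card = j}
  let f : X → (Fin j ↪o Fin n) := fun K => K.1.orderEmbOfFin K.2
  choose ι hI hι1 hι2 hι3 using fun K : X => exists_insertion.{u} (f K).injective
  let v : X → I.quotientPart n := fun K => (I.part n).mkQ (Finsupp.lmapDomain 𝕜 𝕜 (ι K) γ)
  have hrange : ∀ K : X, Set.range (f K) = (K.1 : Set (Fin n)) := fun K =>
    Finset.range_orderEmbOfFin _ _
  have hself : ∀ K : X, Finsupp.lmapDomain 𝕜 𝕜 (pattern (f K))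
      (Finsupp.lmapDomain 𝕜 𝕜 (ι K) γ) = γ := fun K =>
    lmapDomain_lmapDomain_eq_self
      (fun τ => (pattern_eq_iff (f K).injective).2 fun a b => hι1 K τ a b) γ
  have hzero : ∀ K L : X, K ≠ L → Finsupp.lmapDomain 𝕜 𝕜 (pattern (f L))
      (Finsupp.lmapDomain 𝕜 𝕜 (ι K) γ) = 0 := by
    intro K L hKL
    obtain ⟨i, hiK, hiL⟩ : ∃ i, i ∈ K.1 ∧ i ∉ L.1 := by
      by_contra! hc
      refine hKL (Subtype.ext (Finset.eq_of_subset_of_card_le hc ?_))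
      rw [K.2, L.2]
    obtain ⟨x, hx⟩ : i ∈ Set.range (f K) := by rw [hrange]; exact hiK
    refine lmapDomain_lmapDomain_eq_zero (fun σ τ hστ => ?_) (mem_properElements.1 hγ x)
    rw [pattern_eq_pattern_iff (f L).injective, hrange, orderOn_eq_iff]
    rw [orderOn_eq_iff] at hστ
    intro a ha b hb
    have hne : ∀ y, f K y ∈ (L.1 : Set (Fin n)) → y ∈ ({x}ᶜ : Set (Fin j)) := by
      rintro y hy rfl
      exact hiL (hx ▸ hy)
    by_cases haK : a ∈ Set.range (f K)
    · obtain ⟨y, rfl⟩ := haK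
      by_cases hbK : b ∈ Set.range (f K)
      · obtain ⟨z, rfl⟩ := hbK
        rw [hι1, hι1]
        exact hστ y (hne y ha) z (hne z hb)
      · exact iff_of_true (hι2 _ _ _ _ hbK) (hι2 _ _ _ _ hbK)
    · by_cases hbK : b ∈ Set.range (f K)
      · obtain ⟨z, rfl⟩ := hbK
        exact iff_of_false (lt_asymm (hι2 _ _ _ _ haK)) (lt_asymm (hι2 _ _ _ _ haK))
      · exact hι3 K σ τ a b haK hbK
  have hv : LinearIndependent 𝕜 v := by
    classical
    rw [Fintype.linearIndependent_iff]
    intro c hc L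
    have h1 : ∑ K, c K • Finsupp.lmapDomain 𝕜 𝕜 (ι K) γ ∈ I.part n := by
      rw [← Submodule.ker_mkQ (I.part n), LinearMap.mem_ker, map_sum]
      simpa [v] using hc
    have h2 := I.pattern_mem_part (f L) h1
    rw [map_sum, Finset.sum_eq_single L (fun K _ hK => by rw [map_smul, hzero K L hK, smul_zero])
      (by simp), map_smul, hself] at h2
    by_contra hcL
    exact hγI (by simpa [hcL] using (I.part j).smul_mem (c L)⁻¹ h2)
  have hcard := hv.fintype_card_le_finrank
  simpa [X, Fintype.card_finset_len] using hcard

/-- Since patterns of length `q` detect membership, the quotient in arity `n` embeds into a product,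
over the `q`-subsets, of copies of the quotient in arity `q`. -/
theorem finrank_quotientPart_le {q : ℕ}
    (hI : ∀ j, q + 1 ≤ j → properElements 𝕜 j ≤ I.part j) {n : ℕ} (hn : q ≤ n) :
    Module.finrank 𝕜 (I.quotientPart n) ≤ n.choose q * Module.finrank 𝕜 (I.quotientPart q) := by
  let X := {K : Finset (Fin n) // K.card = q}
  let L : (Perm (Fin n) →₀ 𝕜) →ₗ[𝕜] (X → I.quotientPart q) := LinearMap.pi fun K =>
    (I.part q).mkQ ∘ₗ Finsupp.lmapDomain 𝕜 𝕜 (pattern (K.1.orderEmbOfFin K.2))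
  have hL : LinearMap.ker L = I.part n := by
    ext θ
    rw [LinearMap.mem_ker]
    have h1 : L θ = 0 ↔ ∀ K : X,
        Finsupp.lmapDomain 𝕜 𝕜 (pattern (K.1.orderEmbOfFin K.2)) θ ∈ I.part q := by
      rw [funext_iff]
      refine forall_congr' fun K => ?_
      exact Submodule.Quotient.mk_eq_zero _
    rw [h1]
    constructor
    · intro h
      refine I.mem_part_of_pattern_mem hI hn fun f => ?_
      have hcard : (Finset.univ.map f.toEmbedding).card = q := by simp
      have := h ⟨Finset.univ.map f.toEmbedding, hcard⟩
      rwa [← Finset.orderEmbOfFin_unique hcard (f := f) (by simp) f.strictMono] at this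
    · intro h K
      exact I.pattern_mem_part _ h
  have e : I.quotientPart n ≃ₗ[𝕜] LinearMap.range L :=
    (Submodule.quotEquivOfEq _ _ hL.symm).trans L.quotKerEquivRange
  rw [e.finrank_eq]
  refine (Submodule.finrank_le _).trans ?_
  have : Module.Free 𝕜 (I.quotientPart q) := Module.Free.of_divisionRing _ _
  rw [Module.finrank_pi_fintype]
  simp [X, Fintype.card_finset_len]

end OperadicIdeal

end SymmOperad

/-! ### Growth exponents -/

/-- The growth exponent `limsup_n log_n (∑_{i ≤ n} d i)` of a sequence of natural numbers. -/
noncomputable def growthExponent (d : ℕ → ℕ) : EReal :=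
  Filter.limsup (fun n : ℕ =>
    ENNReal.log (∑ i ∈ Finset.range (n + 1), (d i : ENNReal)) / ((Real.log n : ℝ) : EReal))
    Filter.atTop

theorem growthExponent_zero : growthExponent (fun _ => 0) = ⊥ := by
  have h : (fun n : ℕ => ENNReal.log (∑ i ∈ Finset.range (n + 1), ((0 : ℕ) : ENNReal)) /
      ((Real.log n : ℝ) : EReal)) =ᶠ[Filter.atTop] fun _ => ⊥ := by
    -- From `n = 2` on the denominator is positive, so the value is `⊥ / log n = ⊥`.
    filter_upwards [Filter.eventually_ge_atTop 2] with n hn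
    have hlog : 0 < Real.log n := Real.log_pos (by exact_mod_cast hn)
    simp only [Nat.cast_zero, Finset.sum_const_zero, ENNReal.log_zero]
    exact EReal.bot_div_of_pos_ne_top (by exact_mod_cast hlog) (EReal.coe_ne_top _)
  rw [growthExponent, Filter.limsup_congr h]
  simp

/-- The constant `E` disappears after division by `log n`, so bounds by `E * n ^ p` determine the
exponent. -/
theorem tendsto_log_mul_pow (E : ℝ) (p : ℕ) :
    Filter.Tendsto (fun n : ℕ => (((Real.log E + p * Real.log n) / Real.log n : ℝ) : EReal))
      Filter.atTop (nhds ((p : ℝ) : EReal)) := by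
  refine (continuous_coe_real_ereal.tendsto _).comp ?_
  have hlog : Filter.Tendsto (fun n : ℕ => Real.log n) Filter.atTop Filter.atTop :=
    Real.tendsto_log_atTop.comp tendsto_natCast_atTop_atTop
  have h1 : Filter.Tendsto (fun n : ℕ => Real.log E / Real.log n + p) Filter.atTop
      (nhds (0 + p)) := (hlog.const_div_atTop _).add_const _
  rw [zero_add] at h1
  refine h1.congr' ?_
  filter_upwards [hlog.eventually_gt_atTop 0] with n hn
  field_simp

theorem log_mul_pow_div {E : ℝ} (hE : 0 < E) (p : ℕ) {n : ℕ} (hn : 2 ≤ n) :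
    ENNReal.log (ENNReal.ofReal (E * (n : ℝ) ^ p)) / ((Real.log n : ℝ) : EReal) =
      (((Real.log E + p * Real.log n) / Real.log n : ℝ) : EReal) := by
  have hn0 : (0 : ℝ) < n := by positivity
  rw [ENNReal.log_ofReal_of_pos (by positivity), Real.log_mul hE.ne' (by positivity),
    Real.log_pow, EReal.coe_div]

theorem growthExponent_le {d : ℕ → ℕ} {E : ℝ} (hE : 0 < E) {p : ℕ}
    (h : ∀ n : ℕ, 2 ≤ n → (∑ i ∈ Finset.range (n + 1), (d i : ℝ)) ≤ E * (n : ℝ) ^ p) :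
    growthExponent d ≤ (p : ℝ) := by
  rw [← (tendsto_log_mul_pow E p).limsup_eq]
  refine Filter.limsup_le_limsup ?_
  filter_upwards [Filter.eventually_ge_atTop 2] with n hn
  rw [← log_mul_pow_div hE p hn]
  have hlog : 0 ≤ Real.log n := Real.log_nonneg (by exact_mod_cast (by omega : 1 ≤ n))
  refine EReal.div_le_div_right_of_nonneg (by exact_mod_cast hlog) (ENNReal.log_le_log ?_)
  refine le_trans (le_of_eq ?_) (ENNReal.ofReal_le_ofReal (h n hn))
  rw [ENNReal.ofReal_sum_of_nonneg fun i _ => by positivity]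
  simp

theorem le_growthExponent {d : ℕ → ℕ} {E : ℝ} (hE : 0 < E) {p : ℕ} {m : ℕ}
    (h : ∀ n : ℕ, m ≤ n → E * (n : ℝ) ^ p ≤ (∑ i ∈ Finset.range (n + 1), (d i : ℝ))) :
    ((p : ℝ) : EReal) ≤ growthExponent d := by
  rw [← (tendsto_log_mul_pow E p).limsup_eq]
  refine Filter.limsup_le_limsup ?_
  filter_upwards [Filter.eventually_ge_atTop 2, Filter.eventually_ge_atTop m] with n hn hm
  rw [← log_mul_pow_div hE p hn]
  have hlog : 0 ≤ Real.log n := Real.log_nonneg (by exact_mod_cast (by omega : 1 ≤ n))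
  refine EReal.div_le_div_right_of_nonneg (by exact_mod_cast hlog) (ENNReal.log_le_log ?_)
  refine le_trans (ENNReal.ofReal_le_ofReal (h n hm)) (le_of_eq ?_)
  rw [ENNReal.ofReal_sum_of_nonneg fun i _ => by positivity]
  simp

theorem growthExponent_le_of_le_choose {d : ℕ → ℕ} {q c : ℕ}
    (h : ∀ n, q ≤ n → d n ≤ n.choose q * c) : growthExponent d ≤ ((q + 1 : ℕ) : ℝ) := by
  -- The sum absorbs the finitely many terms below `q`, where nothing is assumed.
  let D : ℕ := ∑ i ∈ Finset.range q, d i + c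
  have hd : ∀ n i : ℕ, 1 ≤ n → i ≤ n → d i ≤ D * n ^ q := by
    intro n i hn hi
    have hpos : 1 ≤ n ^ q := Nat.one_le_pow _ _ hn
    by_cases hiq : i < q
    · have h1 : d i ≤ ∑ i ∈ Finset.range q, d i :=
        Finset.single_le_sum (f := d) (fun _ _ => Nat.zero_le _) (Finset.mem_range.2 hiq)
      calc d i ≤ D * 1 := by rw [mul_one]; exact h1.trans (Nat.le_add_right _ _)
        _ ≤ D * n ^ q := Nat.mul_le_mul_left _ hpos
    · have h1 := h i (by omega)
      have h2 : i.choose q ≤ n ^ q :=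
        (Nat.choose_le_pow i q).trans (Nat.pow_le_pow_left hi q)
      calc d i ≤ i.choose q * c := h1
        _ ≤ n ^ q * D := Nat.mul_le_mul h2 (Nat.le_add_left _ _)
        _ = D * n ^ q := mul_comm _ _
  -- The factor 2 comes from `n + 1 ≤ 2 * n`; the summand 1 keeps the constant positive when `D =
  -- 0`.
  refine growthExponent_le (E := 2 * D + 1) (by positivity) fun n hn => ?_
  have h1 : ∑ i ∈ Finset.range (n + 1), d i ≤ (n + 1) * (D * n ^ q) := by
    have := Finset.sum_le_card_nsmul (Finset.range (n + 1)) d (D * n ^ q)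
      fun i hi => hd n i (by omega) (by have := Finset.mem_range.1 hi; omega)
    simpa using this
  have h2 : ∑ i ∈ Finset.range (n + 1), d i ≤ (2 * D + 1) * n ^ (q + 1) := by
    refine h1.trans ?_
    calc (n + 1) * (D * n ^ q) ≤ (2 * n) * (D * n ^ q) := Nat.mul_le_mul_right _ (by omega)
      _ = (2 * D) * n ^ (q + 1) := by ring
      _ ≤ _ := Nat.mul_le_mul_right _ (by omega)
  exact_mod_cast h2

/-- By the hockey-stick identity the partial sums are at least `(n + 1).choose (j + 1)`, hence at
least `(n + 1 - j) ^ (j + 1) / (j + 1)!`. For `n ≥ 2 * j` the base is at least `n / 2`, which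
explains the constant. -/
theorem le_growthExponent_of_choose_le {d : ℕ → ℕ} {j : ℕ} (h : ∀ n, n.choose j ≤ d n) :
    (((j + 1 : ℕ) : ℝ) : EReal) ≤ growthExponent d := by
  have hE : (0 : ℝ) < ((2 ^ (j + 1) * (j + 1).factorial : ℕ) : ℝ) := by positivity
  refine le_growthExponent (E := ((2 ^ (j + 1) * (j + 1).factorial : ℕ) : ℝ)⁻¹) (m := 2 * j)
    (by positivity) fun n hn => ?_
  rw [inv_mul_le_iff₀ hE]
  have h1 : (n + 1).choose (j + 1) ≤ ∑ i ∈ Finset.range (n + 1), d i := by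
    rw [← Nat.sum_Icc_choose]
    refine (Finset.sum_le_sum fun i _ => h i).trans (Finset.sum_le_sum_of_subset fun i hi => ?_)
    have := Finset.mem_Icc.1 hi
    exact Finset.mem_range.2 (by omega)
  have h2 : (n + 1 + 1 - (j + 1)) ^ (j + 1) ≤ (j + 1).factorial * (n + 1).choose (j + 1) := by
    rw [← Nat.descFactorial_eq_factorial_mul_choose]
    exact Nat.pow_sub_le_descFactorial _ _
  have h3 : n ^ (j + 1) ≤ 2 ^ (j + 1) * (j + 1).factorial * ∑ i ∈ Finset.range (n + 1), d i :=
    calc n ^ (j + 1) ≤ (2 * (n + 1 + 1 - (j + 1))) ^ (j + 1) :=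
          Nat.pow_le_pow_left (by omega) _
      _ = 2 ^ (j + 1) * (n + 1 + 1 - (j + 1)) ^ (j + 1) := mul_pow _ _ _
      _ ≤ 2 ^ (j + 1) * ((j + 1).factorial * (n + 1).choose (j + 1)) :=
          Nat.mul_le_mul_left _ h2
      _ ≤ 2 ^ (j + 1) * ((j + 1).factorial * ∑ i ∈ Finset.range (n + 1), d i) :=
          Nat.mul_le_mul_left _ (Nat.mul_le_mul_left _ h1)
      _ = _ := (mul_assoc _ _ _).symm
  exact_mod_cast h3

/-! ### GK dimension and missed proper elements -/

namespace SymmOperad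

variable {𝕜 : Type u} [Field 𝕜]

namespace OperadicIdeal

variable (I : (As 𝕜).OperadicIdeal)

theorem gkdim_eq_growthExponent :
    I.quotient.gkdim = growthExponent fun n => Module.finrank 𝕜 (I.quotientPart n) := by
  have h : ∀ i, ((Cardinal.toENat (Module.rank 𝕜 (I.quotient.obj i)) : ℕ∞) : ENNReal) =
      (Module.finrank 𝕜 (I.quotientPart i) : ENNReal) := by
    intro i
    have h1 : Module.rank 𝕜 (I.quotient.obj i) = Module.rank 𝕜 (I.quotientPart i) := rfl
    rw [h1, ← Module.finrank_eq_rank, Cardinal.toENat_nat]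
    rfl
  simp only [gkdim, growthExponent, h]

theorem gkdim_le {q : ℕ} (hI : ∀ j, q + 1 ≤ j → properElements 𝕜 j ≤ I.part j) :
    I.quotient.gkdim ≤ ((q + 1 : ℕ) : ℝ) := by
  rw [gkdim_eq_growthExponent]
  exact growthExponent_le_of_le_choose fun n hn => I.finrank_quotientPart_le hI hn

theorem le_gkdim {j : ℕ} (hj : ¬ properElements 𝕜 j ≤ I.part j) :
    (((j + 1 : ℕ) : ℝ) : EReal) ≤ I.quotient.gkdim := by
  rw [gkdim_eq_growthExponent]
  obtain ⟨γ, h1, h2⟩ := SetLike.not_le_iff_exists.1 hj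
  exact le_growthExponent_of_choose_le fun n => I.choose_le_finrank h1 h2 n

theorem properElements_le_of_gkdim_lt {j : ℕ} (h : I.quotient.gkdim < ((j + 1 : ℕ) : ℝ)) :
    properElements 𝕜 j ≤ I.part j := by
  by_contra hj
  exact absurd (I.le_gkdim hj) (not_le.2 h)

/-- Such an ideal is everything, so the quotient is zero and the logarithms are `⊥`. -/
theorem gkdim_eq_bot (h : I.part 0 ≠ ⊥) : I.quotient.gkdim = ⊥ := by
  rw [gkdim_eq_growthExponent, ← growthExponent_zero]
  congr 1
  funext n
  have h1 := Submodule.finrank_quotient_add_finrank (I.part n)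
  have h2 : Module.finrank 𝕜 (I.part n) = Module.finrank 𝕜 (Perm (Fin n) →₀ 𝕜) := by
    rw [I.part_eq_top h n, finrank_top]
  change Module.finrank 𝕜 ((Perm (Fin n) →₀ 𝕜) ⧸ I.part n) = 0
  omega

end OperadicIdeal

end SymmOperad

/-! ### Evaluation of multilinear polynomials in algebras -/

/-- Both lists are strictly increasing and have the same members. -/
theorem flatMap_finRange_block {n m : ℕ} (k : Fin n → ℕ) (h : ∑ i, k i = m) :
    (List.finRange n).flatMap (fun i => (List.finRange (k i)).map fun j => blockEquiv k h ⟨i, j⟩) =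
      List.finRange m := by
  have hlt : ((List.finRange n).flatMap
      (fun i => (List.finRange (k i)).map fun j => blockEquiv k h ⟨i, j⟩)).Pairwise (· < ·) := by
    rw [List.pairwise_flatMap]
    refine ⟨fun i _ => ?_, (List.pairwise_lt_finRange n).imp fun {i j} hij => ?_⟩
    · rw [List.pairwise_map]
      refine (List.pairwise_lt_finRange _).imp fun {a b} hab => ?_
      exact (blockEquiv_lt _ _ _ _).2 (Or.inr ⟨rfl, hab⟩)
    · intro x hx y hy
      obtain ⟨a, -, rfl⟩ := List.mem_map.1 hx
      obtain ⟨b, -, rfl⟩ := List.mem_map.1 hy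
      exact (blockEquiv_lt _ _ _ _).2 (Or.inl hij)
  refine List.Perm.eq_of_pairwise' (hlt.imp le_of_lt)
    ((List.pairwise_lt_finRange m).imp le_of_lt) ?_
  refine (List.perm_ext_iff_of_nodup (hlt.imp ne_of_lt) (List.nodup_finRange m)).2 fun p => ?_
  refine iff_of_true ?_ (List.mem_finRange p)
  obtain ⟨⟨i, j⟩, rfl⟩ := (blockEquiv k h).surjective p
  exact List.mem_flatMap.2 ⟨i, List.mem_finRange i, List.mem_map.2 ⟨j, List.mem_finRange j, rfl⟩⟩

theorem prod_ofFn_block {M : Type*} [Monoid M] {n m : ℕ} (k : Fin n → ℕ) (h : ∑ i, k i = m)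
    (a : Fin m → M) :
    (List.ofFn a).prod =
      (List.ofFn fun i => (List.ofFn fun j => a (blockEquiv k h ⟨i, j⟩)).prod).prod := by
  rw [List.ofFn_eq_map, ← flatMap_finRange_block k h, List.map_flatMap, List.flatMap_def,
    List.prod_flatten, List.map_map, List.ofFn_eq_map]
  congr 2
  funext i
  simp [List.ofFn_eq_map, Function.comp_def]

theorem blockPerm_symm_apply {n m : ℕ} (k : Fin n → ℕ) (h : ∑ i, k i = m) (σ : Perm (Fin n))
    (τ : ∀ i, Perm (Fin (k i))) (i : Fin n) (j : Fin (k (σ.symm i))) :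
    (blockPerm k h σ τ).symm
      (blockEquiv (fun a => k (σ.symm a)) ((Equiv.sum_comp σ.symm k).trans h) ⟨i, j⟩) =
      blockEquiv k h ⟨σ.symm i, (τ (σ.symm i)).symm j⟩ := by
  simp only [blockPerm, Equiv.symm_trans_apply, Equiv.symm_symm, Equiv.symm_apply_apply]
  rfl

section

variable (𝕜 : Type u) [Field 𝕜] {A : Type v} [Ring A] [Algebra 𝕜 A]

/-- The evaluation of an element of `𝕜 S_n`, regarded as a multilinear polynomial in `n`
noncommuting variables, at elements of an algebra. -/
noncomputable def asEval {n : ℕ} :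
    (Perm (Fin n) →₀ 𝕜) →ₗ[𝕜] MultilinearMap 𝕜 (fun _ : Fin n => A) A :=
  Finsupp.linearCombination 𝕜 fun σ =>
    (MultilinearMap.mkPiAlgebraFin 𝕜 n A).domDomCongr σ.symm

variable {𝕜}

theorem asEval_single {n : ℕ} (σ : Perm (Fin n)) (a : Fin n → A) :
    asEval 𝕜 (Finsupp.single σ 1) a = (List.ofFn fun p => a (σ.symm p)).prod := by
  simp [asEval]

theorem asEval_apply {n : ℕ} (θ : Perm (Fin n) →₀ 𝕜) (a : Fin n → A) :
    asEval 𝕜 θ a = ∑ σ, θ σ • (List.ofFn fun p => a (σ.symm p)).prod := by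
  simp [asEval, Finsupp.linearCombination_apply, Finsupp.sum_fintype]

theorem asEval_act {n : ℕ} (ρ : Perm (Fin n)) (θ : Perm (Fin n) →₀ 𝕜) (a : Fin n → A) :
    asEval 𝕜 (Finsupp.lmapDomain 𝕜 𝕜 (· * ρ) θ) a = asEval 𝕜 θ (a ∘ ρ.symm) := by
  have : (evalLinear (asEval 𝕜 (A := A)) a).comp (Finsupp.lmapDomain 𝕜 𝕜 (· * ρ)) =
      evalLinear (asEval 𝕜 (A := A)) (a ∘ ρ.symm) := by
    refine Finsupp.lhom_ext' fun σ => LinearMap.ext_ring ?_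
    change asEval 𝕜 (Finsupp.lmapDomain 𝕜 𝕜 (· * ρ) (Finsupp.single σ 1)) a =
      asEval 𝕜 (Finsupp.single σ 1) (a ∘ ρ.symm)
    rw [Finsupp.lmapDomain_apply, Finsupp.mapDomain_single, asEval_single, asEval_single]
    rfl
  exact congrArg (fun f => f θ) this

namespace SymmOperad

/-- Evaluation turns operadic composition into substitution. -/
theorem asEval_asComp {n m : ℕ} (k : Fin n → ℕ) (h : ∑ i, k i = m) (θ : Perm (Fin n) →₀ 𝕜)
    (φ : ∀ i, Perm (Fin (k i)) →₀ 𝕜) (a : Fin m → A) :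
    asEval 𝕜 (asComp 𝕜 k h θ φ) a =
      asEval 𝕜 θ (fun i => asEval 𝕜 (φ i) fun j => a (blockEquiv k h ⟨i, j⟩)) := by
  classical
  have hθ : (evalLinear (asEval 𝕜 (A := A)) a).comp (evalLinear (asComp 𝕜 k h) φ) =
      evalLinear (asEval 𝕜 (A := A))
        (fun i => asEval 𝕜 (φ i) fun j => a (blockEquiv k h ⟨i, j⟩)) := by
    refine Finsupp.lhom_ext' fun σ => LinearMap.ext_ring ?_
    have hφ : (evalLinear (asEval 𝕜 (A := A)) a).compMultilinearMap
          (asComp 𝕜 k h (Finsupp.single σ 1)) =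
        (asEval 𝕜 (A := A) (Finsupp.single σ 1)).compLinearMap
          (fun i => evalLinear (asEval 𝕜 (A := A)) fun j => a (blockEquiv k h ⟨i, j⟩)) := by
      refine multilinear_ext_single fun τ => ?_
      change asEval 𝕜 (asComp 𝕜 k h (Finsupp.single σ 1) fun i => Finsupp.single (τ i) 1) a =
        asEval 𝕜 (Finsupp.single σ 1)
          (fun i => asEval 𝕜 (Finsupp.single (τ i) 1) fun j => a (blockEquiv k h ⟨i, j⟩))
      rw [asComp_single, asEval_single, asEval_single,
        prod_ofFn_block (fun i => k (σ.symm i)) ((Equiv.sum_comp σ.symm k).trans h)]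
      simp only [asEval_single, blockPerm_symm_apply]
    exact congrArg (fun f => f φ) hφ
  exact congrArg (fun f => f θ) hθ

/-- Restriction corresponds to the substitution of `1` for the other variables. -/
theorem asEval_restrict {n : ℕ} (K : Finset (Fin n)) (θ : Perm (Fin n) →₀ 𝕜) (a : Fin n → A)
    (ha : ∀ i, i ∉ K → a i = 1) :
    asEval 𝕜 (Finsupp.lmapDomain 𝕜 𝕜 (pattern (K.orderEmbOfFin rfl)) θ)
      (a ∘ K.orderEmbOfFin rfl) = asEval 𝕜 θ a := by
  have h1 : Finsupp.lmapDomain 𝕜 𝕜 (pattern (K.orderEmbOfFin rfl)) θ =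
      asComp 𝕜 (fun i => (decide (i ∈ K)).toNat) (sum_indicator K) θ
        (fun _ => Finsupp.single 1 1) := by
    have : (Finsupp.lmapDomain 𝕜 𝕜 (pattern (K.orderEmbOfFin rfl))) =
        evalLinear (asComp 𝕜 (fun i => (decide (i ∈ K)).toNat) (sum_indicator K))
          (fun _ => Finsupp.single 1 1) := by
      refine Finsupp.lhom_ext' fun σ => LinearMap.ext_ring ?_
      change Finsupp.lmapDomain 𝕜 𝕜 (pattern (K.orderEmbOfFin rfl)) (Finsupp.single σ 1) =
        asComp 𝕜 _ (sum_indicator K) (Finsupp.single σ 1) (fun _ => Finsupp.single 1 1)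
      rw [asComp_single, blockPerm_indicator]
      simp
    exact congrArg (fun f => f θ) this
  rw [h1, asEval_asComp]
  congr 1
  funext i
  have h2 : ∀ j, (a ∘ K.orderEmbOfFin rfl)
      (blockEquiv (fun i => (decide (i ∈ K)).toNat) (sum_indicator K) ⟨i, j⟩) = a i := by
    intro j
    rw [Function.comp_apply, ← blockEquiv_indicator, Equiv.symm_apply_apply]
  rw [asEval_single]
  simp only [h2]
  rw [List.ofFn_const, List.prod_replicate]
  by_cases hi : i ∈ K
  · simp [hi]
  · simp [ha i hi]

/-- Substituting 1 for a variable is evaluating after deletion of that letter. -/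
theorem asEval_eq_zero_of_eq_one {n : ℕ} {θ : Perm (Fin n) →₀ 𝕜} (hθ : θ ∈ properElements 𝕜 n)
    {a : Fin n → A} {i : Fin n} (hi : a i = 1) : asEval 𝕜 θ a = 0 := by
  let K : Finset (Fin n) := {i}ᶜ
  rw [← asEval_restrict K θ a (fun j hj => by
    have : j = i := by simpa [K] using hj
    rw [this, hi])]
  rw [lmapDomain_eq_zero_of_fibers (q := pattern (K.orderEmbOfFin rfl)) (fun σ τ hστ => ?_)
    (mem_properElements.1 hθ i)]
  · simp
  · rw [pattern_eq_pattern_iff (K.orderEmbOfFin rfl).injective, Finset.range_orderEmbOfFin]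
    simpa [K] using hστ

/-- Proper elements of degree `n` vanish on algebras of the form `𝕜 1 + N` with `N ^ n = 0`. -/
theorem asEval_eq_zero_of_nilpotent {n : ℕ} {θ : Perm (Fin n) →₀ 𝕜}
    (hθ : θ ∈ properElements 𝕜 n) (S N : Set A)
    (hS : ∀ x ∈ S, ∃ (c : 𝕜), ∃ y ∈ N, x = y + c • 1)
    (hN : ∀ a : Fin n → A, (∀ i, a i ∈ N) → (List.ofFn a).prod = 0) (a : Fin n → A)
    (ha : ∀ i, a i ∈ S) : asEval 𝕜 θ a = 0 := by
  -- Induction on the set of variables not yet replaced by their parts in `N`. By multilinearity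
  -- each scalar part contributes an evaluation with a variable equal to 1, which is zero.
  suffices key : ∀ (s : Finset (Fin n)) (a : Fin n → A), (∀ i ∈ s, a i ∈ S) →
      (∀ i ∉ s, a i ∈ N) → asEval 𝕜 θ a = 0 from
    key Finset.univ a (fun i _ => ha i) (by simp)
  intro s
  induction s using Finset.induction_on with
  | empty =>
    intro a _ h
    rw [asEval_apply]
    refine Finset.sum_eq_zero fun σ _ => ?_
    rw [hN _ fun i => h _ (Finset.notMem_empty _), smul_zero]
  | insert i s hi ih =>
    intro a h1 h2
    obtain ⟨c, y, hy, hxy⟩ := hS _ (h1 i (Finset.mem_insert_self _ _))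
    have : a = Function.update a i (y + c • 1) := by rw [← hxy, Function.update_eq_self]
    rw [this, MultilinearMap.map_update_add, MultilinearMap.map_update_smul,
      asEval_eq_zero_of_eq_one hθ (a := Function.update a i 1) (i := i) (by simp), smul_zero, add_zero]
    refine ih _ (fun j hj => ?_) (fun j hj => ?_)
    · have hji : j ≠ i := fun h => hi (h ▸ hj)
      rw [Function.update_of_ne hji]
      exact h1 j (Finset.mem_insert_of_mem hj)
    · by_cases hji : j = i
      · subst hji; simpa using hy
      · rw [Function.update_of_ne hji]
        exact h2 j (by simp [hji, hj])

theorem asEval_mem {n : ℕ} (S : Subalgebra 𝕜 A) (θ : Perm (Fin n) →₀ 𝕜) {a : Fin n → A}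
    (ha : ∀ i, a i ∈ S) : asEval 𝕜 θ a ∈ S := by
  rw [asEval_apply]
  refine sum_mem fun σ _ => S.smul_mem (list_prod_mem fun x hx => ?_) _
  obtain ⟨i, rfl⟩ := List.mem_ofFn.1 hx
  exact ha _

/-- The ideal of `As` of multilinear polynomial identities of a subalgebra. -/
noncomputable def identityIdeal (S : Subalgebra 𝕜 A) : (As 𝕜).OperadicIdeal where
  carrier n := ({
    carrier := {θ | ∀ a : Fin n → A, (∀ i, a i ∈ S) → asEval 𝕜 θ a = 0}
    add_mem' := fun {x y} hx hy a ha => by simp [hx a ha, hy a ha]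
    zero_mem' := fun a _ => by simp
    smul_mem' := fun c x hx a ha => by simp [hx a ha] } : Submodule 𝕜 (Perm (Fin n) →₀ 𝕜))
  act_mem σ θ hθ a ha := (asEval_act σ _ a).trans (hθ _ fun i => ha _)
  comp_mem_left k h θ φ hθ a ha :=
    (asEval_asComp k h θ φ a).trans (hθ _ fun i => asEval_mem S _ fun j => ha _)
  comp_mem_right k h θ φ i hi a ha :=
    (asEval_asComp k h θ φ a).trans
      ((asEval 𝕜 θ).map_coord_zero i (hi _ fun j => ha _))

theorem mem_identityIdeal {S : Subalgebra 𝕜 A} {n : ℕ} {θ : Perm (Fin n) →₀ 𝕜} :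
    θ ∈ (identityIdeal S).part n ↔ ∀ a : Fin n → A, (∀ i, a i ∈ S) → asEval 𝕜 θ a = 0 :=
  Iff.rfl

/-- An element is proper if it vanishes as soon as one variable is set to `1`, in a subalgebra
without identities of the same degree. -/
theorem mem_properElements_of_asEval {S : Subalgebra 𝕜 A} {n : ℕ}
    (hS : (identityIdeal S).part n = ⊥) {θ : Perm (Fin n) →₀ 𝕜}
    (h : ∀ a : Fin n → A, ∀ i, a i = 1 → asEval 𝕜 θ a = 0) : θ ∈ properElements 𝕜 n := by
  refine mem_properElements.2 fun i => ?_
  let K : Finset (Fin n) := {i}ᶜ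
  have hK : K.card ≤ n := (Finset.card_le_univ K).trans (by simp)
  have h1 : Finsupp.lmapDomain 𝕜 𝕜 (pattern (K.orderEmbOfFin rfl)) θ = 0 := by
    -- It suffices that the deletion is an identity of `S`, since `S` has none in lower degrees
    -- either; its values are values of `θ` with 1 in the deleted place.
    rw [← Submodule.mem_bot 𝕜, ← (identityIdeal S).part_eq_bot_of_le hK hS, mem_identityIdeal]
    intro b hb
    obtain ⟨a, ha1, ha2⟩ : ∃ a : Fin n → A, a ∘ K.orderEmbOfFin rfl = b ∧
        ∀ i, i ∉ K → a i = 1 := by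
      refine ⟨Function.extend (K.orderEmbOfFin rfl) b (fun _ => 1), ?_, fun i hi => ?_⟩
      · exact Function.extend_comp (K.orderEmbOfFin rfl).injective _ _
      · refine Function.extend_apply' _ _ _ ?_
        rintro ⟨x, hx⟩
        exact hi (hx ▸ Finset.orderEmbOfFin_mem _ _ _)
    rw [← ha1, asEval_restrict K θ a ha2]
    exact h a i (ha2 i (by simp [K]))
  refine lmapDomain_eq_zero_of_fibers (fun σ τ hστ => ?_) h1
  rw [pattern_eq_pattern_iff (K.orderEmbOfFin rfl).injective, Finset.range_orderEmbOfFin] at hστ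
  simpa [K] using hστ

end SymmOperad

end

/-! ### Two algebras of triangular matrices -/

namespace SymmOperad

section

variable (𝕜 : Type u) [Field 𝕜]

/-- The algebra of upper triangular `5 × 5` matrices with constant diagonal. -/
def upperUnipotentAlgebra : Subalgebra 𝕜 (Matrix (Fin 5) (Fin 5) 𝕜) where
  carrier := {M | (∀ i j, j < i → M i j = 0) ∧ ∀ i, M i i = M 0 0}
  mul_mem' := by
    rintro M N ⟨hM, hM'⟩ ⟨hN, hN'⟩
    have hdiag : ∀ i, (M * N) i i = M i i * N i i := by
      intro i
      rw [Matrix.mul_apply]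
      refine Finset.sum_eq_single i (fun k _ hk => ?_) (by simp)
      rcases lt_or_gt_of_ne hk with h | h
      · rw [hM _ _ h, zero_mul]
      · rw [hN _ _ h, mul_zero]
    refine ⟨fun i j hij => ?_, fun i => ?_⟩
    · rw [Matrix.mul_apply]
      refine Finset.sum_eq_zero fun k _ => ?_
      rcases lt_or_ge k i with h | h
      · rw [hM _ _ h, zero_mul]
      · rw [hN _ _ (hij.trans_le h), mul_zero]
    · rw [hdiag, hdiag, hM' i, hN' i]
  add_mem' := by
    rintro M N ⟨hM, hM'⟩ ⟨hN, hN'⟩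
    refine ⟨fun i j hij => ?_, fun i => ?_⟩
    · rw [Matrix.add_apply, hM _ _ hij, hN _ _ hij, add_zero]
    · rw [Matrix.add_apply, Matrix.add_apply, hM' i, hN' i]
  algebraMap_mem' := by
    intro c
    refine ⟨fun i j hij => ?_, fun i => ?_⟩
    · rw [Matrix.algebraMap_matrix_apply, if_neg hij.ne']
    · simp [Matrix.algebraMap_matrix_apply]

/-- The matrices in `upperUnipotentAlgebra` whose lower right `4 × 4` block is a Toeplitz matrix. -/
def toeplitzAlgebra : Subalgebra 𝕜 (Matrix (Fin 5) (Fin 5) 𝕜) where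
  carrier := {M | M ∈ upperUnipotentAlgebra 𝕜 ∧ M 1 2 = M 2 3 ∧ M 2 3 = M 3 4 ∧ M 1 3 = M 2 4}
  mul_mem' := by
    rintro M N ⟨hM, h1, h2, h3⟩ ⟨hN, h4, h5, h6⟩
    refine ⟨mul_mem hM hN, ?_⟩
    obtain ⟨hM, hM'⟩ := hM
    obtain ⟨hN, hN'⟩ := hN
    simp only [Matrix.mul_apply, Fin.sum_univ_five]
    simp [hM' 1, hM' 2, hM' 3, hN' 2, hN' 3, hN' 4, h1, h2, h3, h4, h5, h6,
      hM 1 0, hM 2 0, hM 2 1, hM 3 0, hM 3 1, hM 3 2, hN 4 3, hN 4 2, hN 3 2]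
  add_mem' := by
    rintro M N ⟨hM, h1, h2, h3⟩ ⟨hN, h4, h5, h6⟩
    exact ⟨add_mem hM hN, by simp [h1, h2, h4, h5], by simp [h2, h5], by simp [h3, h6]⟩
  algebraMap_mem' := by
    intro c
    exact ⟨Subalgebra.algebraMap_mem _ c, by simp [Matrix.algebraMap_matrix_apply]⟩

theorem toeplitzAlgebra_le : toeplitzAlgebra 𝕜 ≤ upperUnipotentAlgebra 𝕜 := fun _ h => h.1

variable {𝕜}

/-- Each strictly upper triangular factor raises the index by at least 1; with five factors no entry
is left. -/
theorem prod_strictUpper (L : List (Matrix (Fin 5) (Fin 5) 𝕜))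
    (hL : ∀ M ∈ L, ∀ i j, j ≤ i → M i j = 0) (i j : Fin 5) (hij : (j : ℕ) < i + L.length) :
    L.prod i j = 0 := by
  induction L generalizing i with
  | nil =>
    have : i ≠ j := fun h => by simp [h] at hij
    simp [this]
  | cons M L ih =>
    rw [List.prod_cons, Matrix.mul_apply]
    refine Finset.sum_eq_zero fun k _ => ?_
    rcases le_or_gt k i with h | h
    · rw [hL M (by simp) _ _ h, zero_mul]
    · rw [ih (fun M hM => hL M (by simp [hM])) k ?_, mul_zero]
      have : (i : ℕ) < k := h
      rw [List.length_cons] at hij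
      omega

theorem properElements_le_identityIdeal {n : ℕ} (hn : 5 ≤ n)
    {S : Subalgebra 𝕜 (Matrix (Fin 5) (Fin 5) 𝕜)} (hS : S ≤ upperUnipotentAlgebra 𝕜) :
    properElements 𝕜 n ≤ (identityIdeal S).part n := by
  intro θ hθ
  rw [mem_identityIdeal]
  intro a ha
  refine asEval_eq_zero_of_nilpotent hθ (upperUnipotentAlgebra 𝕜)
    {M | ∀ i j, j ≤ i → M i j = 0} ?_ ?_ a fun i => hS (ha i)
  · rintro M ⟨hM, hM'⟩
    -- The diagonal is constant, so removing this scalar leaves a strictly upper triangular matrix.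
    refine ⟨M 0 0, M - M 0 0 • 1, ?_, by simp⟩
    intro i j hij
    rcases hij.lt_or_eq with h | rfl
    · simp [hM _ _ h, h.ne']
    · simp [hM' j]
  · intro b hb
    ext i j
    refine prod_strictUpper _ (fun M hM => ?_) i j ?_
    · obtain ⟨p, rfl⟩ := List.mem_ofFn.1 hM
      exact hb p
    · rw [List.length_ofFn]
      omega

theorem single_mul_apply (p q i j : Fin 5) (M : Matrix (Fin 5) (Fin 5) 𝕜) :
    (Matrix.single p q (1 : 𝕜) * M) i j = if i = p then M q j else 0 := by
  by_cases h : i = p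
  · subst h; simp
  · simp [h]

theorem single_succ_mem (p : Fin 4) :
    Matrix.single p.castSucc p.succ (1 : 𝕜) ∈ upperUnipotentAlgebra 𝕜 := by
  have hne : ∀ i : Fin 5, Matrix.single p.castSucc p.succ (1 : 𝕜) i i = 0 := by
    intro i
    rw [Matrix.single_apply, if_neg]
    rintro ⟨rfl, h⟩
    exact (Fin.castSucc_lt_succ (i := p)).ne' h
  refine ⟨fun i j hij => ?_, fun i => by rw [hne, hne]⟩
  rw [Matrix.single_apply, if_neg]
  rintro ⟨rfl, rfl⟩
  exact lt_asymm hij Fin.castSucc_lt_succ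

/-- Four matrix units, each making one step to the next index, lead from 0 to 4 only when taken in
order. -/
theorem prod_single_succ_apply (q : Fin 4 → Fin 4) :
    (Matrix.single (q 0).castSucc (q 0).succ (1 : 𝕜) *
      (Matrix.single (q 1).castSucc (q 1).succ (1 : 𝕜) *
        (Matrix.single (q 2).castSucc (q 2).succ (1 : 𝕜) *
          (Matrix.single (q 3).castSucc (q 3).succ (1 : 𝕜) * 1))) :
              Matrix (Fin 5) (Fin 5) 𝕜) 0 4 =
      if ∀ i, q i = i then 1 else 0 := by
  rw [single_mul_apply, single_mul_apply, single_mul_apply, single_mul_apply, Matrix.one_apply,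
    ← ite_and, ← ite_and, ← ite_and, ← ite_and]
  refine if_congr ?_ rfl rfl
  simp only [Fin.forall_fin_succ, Fin.ext_iff, IsEmpty.forall_iff, Fin.val_succ,
    Fin.val_castSucc]
  simp
  omega

/-- Substituting the step matrices in the order prescribed by `τ` makes `τ` the only monomial with
nonzero `(0, 4)` entry, so that entry of the value is the coefficient of `τ`. -/
theorem identityIdeal_upperUnipotentAlgebra_four :
    (identityIdeal (upperUnipotentAlgebra 𝕜)).part 4 = ⊥ := by
  rw [Submodule.eq_bot_iff]
  intro θ hθ
  rw [mem_identityIdeal] at hθ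
  refine Finsupp.ext fun τ => ?_
  have h := hθ (fun i => Matrix.single (τ i).castSucc (τ i).succ (1 : 𝕜))
    fun i => single_succ_mem _
  have hprod : ∀ σ : Perm (Fin 4), (List.ofFn fun p =>
      Matrix.single (τ (σ.symm p)).castSucc (τ (σ.symm p)).succ (1 : 𝕜)).prod 0 4 =
        if σ = τ then 1 else 0 := by
    intro σ
    have h1 := prod_single_succ_apply (𝕜 := 𝕜) fun p => τ (σ.symm p)
    have h2 : (∀ i, τ (σ.symm i) = i) ↔ σ = τ := by
      constructor
      · intro h
        ext i
        rw [← h (σ i), Equiv.symm_apply_apply]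
      · rintro rfl i
        exact Equiv.apply_symm_apply σ i
    exact h1.trans (if_congr h2 rfl rfl)
  rw [asEval_apply] at h
  have h' := congrFun (congrFun h 0) 4
  rw [Matrix.sum_apply] at h'
  simp only [Matrix.smul_apply, hprod] at h'
  simpa using h'

end

/-! ### Commutators and binary compositions -/

section

variable {𝕜 : Type u} [Field 𝕜]

variable (𝕜) in
/-- The commutator `x₁ x₂ - x₂ x₁`. -/
noncomputable def commutator : Perm (Fin 2) →₀ 𝕜 :=
  Finsupp.single 1 1 - Finsupp.single (swap 0 1) 1

theorem asEval_commutator {A : Type v} [Ring A] [Algebra 𝕜 A] (a : Fin 2 → A) :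
    asEval 𝕜 (commutator 𝕜) a = a 0 * a 1 - a 1 * a 0 := by
  rw [commutator, map_sub, sub_apply, asEval_single, asEval_single]
  simp [List.ofFn_succ, show ∀ p, (Equiv.symm (1 : Perm (Fin 2))) p = p from fun _ => rfl]

/-- Here `ζ` is `β ∘ (θ, η)`. Only its values, the numbering of the variables and its membership in
ideals containing `β` are kept, which hides the dependent family of arguments. -/
theorem exists_binary_comp_of_sum {n : ℕ} {s : Fin 2 → ℕ} (hs : ∑ i, s i = n)
    (β : Perm (Fin 2) →₀ 𝕜) (θ : Perm (Fin (s 0)) →₀ 𝕜) (η : Perm (Fin (s 1)) →₀ 𝕜) :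
    ∃ (ζ : Perm (Fin n) →₀ 𝕜) (f : Fin (s 0) → Fin n) (g : Fin (s 1) → Fin n),
      (∀ x, (f x : ℕ) = x) ∧ (∀ x, (g x : ℕ) = s 0 + x) ∧
      (∀ I : (As 𝕜).OperadicIdeal, β ∈ I.part 2 → ζ ∈ I.part n) ∧
      ∀ {A : Type u} [Ring A] [Algebra 𝕜 A] (a : Fin n → A),
        asEval 𝕜 ζ a = asEval 𝕜 β ![asEval 𝕜 θ (a ∘ f), asEval 𝕜 η (a ∘ g)] := by
  let φ : ∀ i, Perm (Fin (s i)) →₀ 𝕜 :=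
    Fin.cases θ (fun j => by rw [Subsingleton.elim j 0]; exact η)
  refine ⟨asComp 𝕜 s hs β φ, fun x => blockEquiv s hs ⟨0, x⟩, fun x => blockEquiv s hs ⟨1, x⟩,
    ?_, ?_, fun I h => I.asComp_mem_left s hs φ h, ?_⟩
  · intro x
    simp [blockEquiv, finSigmaFinEquiv_apply]
  · intro x
    simp [blockEquiv, finSigmaFinEquiv_apply]
  · intro A _ _ a
    rw [asEval_asComp]
    congr 1
    funext i
    refine Fin.cases ?_ (fun j => ?_) i
    · rfl
    · rw [Subsingleton.elim j 0]
      rfl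

theorem exists_binary_comp {k m n : ℕ} (h : k + m = n)
    (β : Perm (Fin 2) →₀ 𝕜) (θ : Perm (Fin k) →₀ 𝕜) (η : Perm (Fin m) →₀ 𝕜) :
    ∃ (ζ : Perm (Fin n) →₀ 𝕜) (f : Fin k → Fin n) (g : Fin m → Fin n),
      (∀ x, (f x : ℕ) = x) ∧ (∀ x, (g x : ℕ) = k + x) ∧
      (∀ I : (As 𝕜).OperadicIdeal, β ∈ I.part 2 → ζ ∈ I.part n) ∧
      ∀ {A : Type u} [Ring A] [Algebra 𝕜 A] (a : Fin n → A),
        asEval 𝕜 ζ a = asEval 𝕜 β ![asEval 𝕜 θ (a ∘ f), asEval 𝕜 η (a ∘ g)] :=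
  exists_binary_comp_of_sum (s := ![k, m]) (by simpa [Fin.sum_univ_two] using h) β θ η

end

end SymmOperad

/-! ### Two quotients of GK dimension 5 -/

namespace SymmOperad

variable {𝕜 : Type u} [Field 𝕜]

/-- Commutators in `toeplitzAlgebra` are concentrated in the first row. -/
theorem commutator_toeplitzAlgebra {M N : Matrix (Fin 5) (Fin 5) 𝕜} (hM : M ∈ toeplitzAlgebra 𝕜)
    (hN : N ∈ toeplitzAlgebra 𝕜) (i j : Fin 5) (hij : i ≠ 0 ∨ j = 0) :
    (M * N - N * M) i j = 0 := by
  obtain ⟨⟨hM, hM'⟩, h1, h2, h3⟩ := hM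
  obtain ⟨⟨hN, hN'⟩, h4, h5, h6⟩ := hN
  simp only [Matrix.sub_apply, Matrix.mul_apply, Fin.sum_univ_five]
  have m1 := hM' 1; have m2 := hM' 2; have m3 := hM' 3; have m4 := hM' 4
  have n1 := hN' 1; have n2 := hN' 2; have n3 := hN' 3; have n4 := hN' 4
  have hi : i = 0 ∨ i = 1 ∨ i = 2 ∨ i = 3 ∨ i = 4 := by omega
  have hj : j = 0 ∨ j = 1 ∨ j = 2 ∨ j = 3 ∨ j = 4 := by omega
  have z10 := hM 1 0 (by decide); have z20 := hM 2 0 (by decide); have z21 := hM 2 1 (by decide)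
  have z30 := hM 3 0 (by decide); have z31 := hM 3 1 (by decide); have z32 := hM 3 2 (by decide)
  have z40 := hM 4 0 (by decide); have z41 := hM 4 1 (by decide); have z42 := hM 4 2 (by decide)
  have z43 := hM 4 3 (by decide)
  have w10 := hN 1 0 (by decide); have w20 := hN 2 0 (by decide); have w21 := hN 2 1 (by decide)
  have w30 := hN 3 0 (by decide); have w31 := hN 3 1 (by decide); have w32 := hN 3 2 (by decide)
  have w40 := hN 4 0 (by decide); have w41 := hN 4 1 (by decide); have w42 := hN 4 2 (by decide)
  have w43 := hN 4 3 (by decide)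
  rcases hi with rfl | rfl | rfl | rfl | rfl <;> rcases hj with rfl | rfl | rfl | rfl | rfl <;>
    first
    | exact absurd hij (by decide)
    | (simp only [m1, m2, m3, m4, n1, n2, n3, n4, h1, h2, h3, h4, h5, h6, z10, z20, z21, z30, z31,
        z32, z40, z41, z42, z43, w10, w20, w21, w30, w31, w32, w40, w41, w42, w43]; ring)

theorem asEval_one_two {A : Type v} [Ring A] [Algebra 𝕜 A] (a : Fin 2 → A) :
    asEval 𝕜 (Finsupp.single 1 1) a = a 0 * a 1 := by
  rw [asEval_single]
  simp [List.ofFn_succ, show ∀ p, (Equiv.symm (1 : Perm (Fin 2))) p = p from fun _ => rfl]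

theorem asEval_one_one {A : Type v} [Ring A] [Algebra 𝕜 A] (a : Fin 1 → A) :
    asEval 𝕜 (Finsupp.single 1 1) a = a 0 := by
  rw [asEval_single]
  simp [show ∀ p, (Equiv.symm (1 : Perm (Fin 1))) p = p from fun _ => rfl]

variable (𝕜) in
-- The identity is `[x₁, x₂] [x₃, x₄]`: the first commutator has zero first column and the second
-- has only its first row, so the product vanishes.
theorem identityIdeal_toeplitzAlgebra_four_ne_bot :
    (identityIdeal (toeplitzAlgebra 𝕜)).part 4 ≠ ⊥ := by
  obtain ⟨ζ, f, g, hf, hg, -, hζ⟩ := exists_binary_comp (show 2 + 2 = 4 from rfl)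
    (Finsupp.single 1 1) (commutator 𝕜) (commutator 𝕜)
  have hf0 : f 0 = 0 := Fin.ext (hf 0)
  have hf1 : f 1 = 1 := Fin.ext (hf 1)
  have hg0 : g 0 = 2 := Fin.ext (hg 0)
  have hg1 : g 1 = 3 := Fin.ext (hg 1)
  have hev : ∀ a : Fin 4 → Matrix (Fin 5) (Fin 5) 𝕜, asEval 𝕜 ζ a =
      (a 0 * a 1 - a 1 * a 0) * (a 2 * a 3 - a 3 * a 2) := by
    intro a
    rw [hζ, asEval_one_two, Matrix.cons_val_zero, Matrix.cons_val_one, Matrix.cons_val_zero,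
      asEval_commutator, asEval_commutator]
    simp only [Function.comp_apply, hf0, hf1, hg0, hg1]
  refine (Submodule.ne_bot_iff _).2 ⟨ζ, mem_identityIdeal.2 fun a ha => ?_, fun h0 => ?_⟩
  · rw [hev]
    ext i j
    rw [Matrix.mul_apply]
    refine Finset.sum_eq_zero fun k _ => ?_
    by_cases hk : k = 0
    · rw [commutator_toeplitzAlgebra (ha 0) (ha 1) i k (Or.inr hk), zero_mul]
    · rw [commutator_toeplitzAlgebra (ha 2) (ha 3) k j (Or.inl hk), mul_zero]
  -- To see that `ζ ≠ 0` any matrices may be used, not only those in `toeplitzAlgebra`.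
  · have h := hev fun i => Matrix.single i.castSucc i.succ 1
    rw [h0, map_zero, zero_apply] at h
    have h' := congrFun (congrFun h 0) 4
    simp [Matrix.single_mul_single_of_ne] at h'

variable (𝕜) in
theorem exists_triple_commutator : ∃ ζ : Perm (Fin 3) →₀ 𝕜,
    (∀ I : (As 𝕜).OperadicIdeal, commutator 𝕜 ∈ I.part 2 → ζ ∈ I.part 3) ∧
    ∀ {A : Type u} [Ring A] [Algebra 𝕜 A] (a : Fin 3 → A), asEval 𝕜 ζ a =
      (a 0 * a 1 - a 1 * a 0) * a 2 - a 2 * (a 0 * a 1 - a 1 * a 0) := by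
  obtain ⟨ζ, f, g, hf, hg, hI, hζ⟩ := exists_binary_comp (show 2 + 1 = 3 from rfl)
    (commutator 𝕜) (commutator 𝕜) (Finsupp.single 1 1)
  have hf0 : f 0 = 0 := Fin.ext (hf 0)
  have hf1 : f 1 = 1 := Fin.ext (hf 1)
  have hg0 : g 0 = 2 := Fin.ext (hg 0)
  refine ⟨ζ, hI, fun a => ?_⟩
  rw [hζ, asEval_commutator, Matrix.cons_val_zero, Matrix.cons_val_one, Matrix.cons_val_zero,
    asEval_commutator, asEval_one_one]
  simp only [Function.comp_apply, hf0, hf1, hg0]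

variable (𝕜) in
theorem exists_quadruple_commutator : ∃ ζ : Perm (Fin 4) →₀ 𝕜,
    ∀ {A : Type u} [Ring A] [Algebra 𝕜 A] (a : Fin 4 → A), asEval 𝕜 ζ a =
      ((a 0 * a 1 - a 1 * a 0) * a 2 - a 2 * (a 0 * a 1 - a 1 * a 0)) * a 3 -
        a 3 * ((a 0 * a 1 - a 1 * a 0) * a 2 - a 2 * (a 0 * a 1 - a 1 * a 0)) := by
  obtain ⟨θ, -, hθ⟩ := exists_triple_commutator 𝕜
  obtain ⟨ζ, f, g, hf, hg, -, hζ⟩ := exists_binary_comp (show 3 + 1 = 4 from rfl)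
    (commutator 𝕜) θ (Finsupp.single 1 1)
  have hf0 : f 0 = 0 := Fin.ext (hf 0)
  have hf1 : f 1 = 1 := Fin.ext (hf 1)
  have hf2 : f 2 = 2 := Fin.ext (hf 2)
  have hg0 : g 0 = 3 := Fin.ext (hg 0)
  refine ⟨ζ, fun a => ?_⟩
  rw [hζ, asEval_commutator, Matrix.cons_val_zero, Matrix.cons_val_one, Matrix.cons_val_zero,
    hθ, asEval_one_one]
  simp only [Function.comp_apply, hf0, hf1, hf2, hg0]

variable (𝕜) in
-- The witness is `[[[x₁, x₂], x₃], x₄]`. It vanishes when a variable is 1, and the larger algebra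
-- has no identities of degree 4, so it is proper.
theorem not_properElements_four_le :
    ¬ properElements 𝕜 4 ≤ (identityIdeal (toeplitzAlgebra 𝕜)).part 4 := by
  obtain ⟨ζ, hζ⟩ := exists_quadruple_commutator 𝕜
  intro hle
  have hproper : ζ ∈ properElements 𝕜 4 := by
    refine mem_properElements_of_asEval identityIdeal_upperUnipotentAlgebra_four fun a i hi => ?_
    rw [hζ]
    have h : i = 0 ∨ i = 1 ∨ i = 2 ∨ i = 3 := by omega
    rcases h with rfl | rfl | rfl | rfl <;> rw [hi] <;> simp
  -- Chosen so that `x * y = 0`: the iterated commutator of `y` with three copies of `x` collapses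
  -- to `y * x * x * x`, which is a matrix unit.
  let y : Matrix (Fin 5) (Fin 5) 𝕜 := Matrix.single 0 1 1
  let x : Matrix (Fin 5) (Fin 5) 𝕜 := Matrix.single 1 2 1 + Matrix.single 2 3 1 + Matrix.single 3 4 1
  have hy : y ∈ toeplitzAlgebra 𝕜 := by
    refine ⟨single_succ_mem 0, ?_⟩
    simp [y]
  have hx : x ∈ toeplitzAlgebra 𝕜 := by
    refine ⟨add_mem (add_mem (single_succ_mem 1) (single_succ_mem 2)) (single_succ_mem 3), ?_⟩
    simp [x]
  have h := mem_identityIdeal.1 (hle hproper) ![y, x, x, x] fun i => by fin_cases i <;> simp [hx, hy]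
  have hxy : x * y = 0 := by simp [x, y, add_mul, Matrix.single_mul_single_of_ne]
  have hyx : y * x * x * x = Matrix.single 0 4 1 := by
    simp [x, y, mul_add, Matrix.single_mul_single_of_ne]
  rw [hζ] at h
  simp only [Matrix.cons_val] at h
  simp only [hxy, sub_zero, ← mul_assoc, zero_mul] at h
  rw [hyx] at h
  have h' := congrFun (congrFun h 0) 4
  simp at h'

theorem identityIdeal_mono {A : Type v} [Ring A] [Algebra 𝕜 A] {S T : Subalgebra 𝕜 A}
    (h : S ≤ T) (n : ℕ) : (identityIdeal T).part n ≤ (identityIdeal S).part n :=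
  fun _ hθ a ha => hθ a fun i => h (ha i)

/-- The upper bound is inherited from the larger algebra and the missed proper element from the
smaller one. -/
theorem gkdim_identityIdeal {S : Subalgebra 𝕜 (Matrix (Fin 5) (Fin 5) 𝕜)}
    (h1 : toeplitzAlgebra 𝕜 ≤ S) (h2 : S ≤ upperUnipotentAlgebra 𝕜) :
    (identityIdeal S).quotient.gkdim = 5 := by
  refine le_antisymm ?_ ?_
  · have := (identityIdeal S).gkdim_le (q := 4) fun j hj => properElements_le_identityIdeal hj h2
    exact_mod_cast this
  · have := (identityIdeal S).le_gkdim (j := 4) fun h =>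
      not_properElements_four_le 𝕜 (h.trans (identityIdeal_mono h1 4))
    exact_mod_cast this

/-- An isomorphism would preserve the finite dimension in arity `n`, which a nonzero `J.part n`
lowers. -/
theorem not_isomorphic_of_part {I J : (As 𝕜).OperadicIdeal} {n : ℕ} (hI : I.part n = ⊥)
    (hJ : J.part n ≠ ⊥) : ¬ Isomorphic I.quotient J.quotient := by
  rintro ⟨f, g, hgf, hfg⟩
  let e : I.quotientPart n ≃ₗ[𝕜] J.quotientPart n :=
    LinearEquiv.ofLinearMap (f.toFun n) (g.toFun n) (LinearMap.ext (hfg n)) (LinearMap.ext (hgf n))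
  have h1 := e.finrank_eq
  have h2 := Submodule.finrank_quotient_add_finrank (I.part n)
  have h3 := Submodule.finrank_quotient_add_finrank (J.part n)
  rw [← Submodule.finrank_eq_zero] at hI
  have h4 : Module.finrank 𝕜 (J.part n) ≠ 0 := fun h => hJ (Submodule.finrank_eq_zero.1 h)
  change Module.finrank 𝕜 ((Perm (Fin n) →₀ 𝕜) ⧸ I.part n) =
    Module.finrank 𝕜 ((Perm (Fin n) →₀ 𝕜) ⧸ J.part n) at h1
  omega

variable (𝕜) in
theorem exists_nonisomorphic_gkdim_five : ∃ I J : (As 𝕜).OperadicIdeal,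
    I.quotient.gkdim = 5 ∧ J.quotient.gkdim = 5 ∧ ¬ Isomorphic I.quotient J.quotient :=
  ⟨identityIdeal (upperUnipotentAlgebra 𝕜), identityIdeal (toeplitzAlgebra 𝕜),
    gkdim_identityIdeal (toeplitzAlgebra_le 𝕜) le_rfl,
    gkdim_identityIdeal le_rfl (toeplitzAlgebra_le 𝕜),
    not_isomorphic_of_part identityIdeal_upperUnipotentAlgebra_four
      (identityIdeal_toeplitzAlgebra_four_ne_bot 𝕜)⟩

end SymmOperad

/-! ### Proper elements of low degree -/

/-- Properness read off coefficient by coefficient: the sum runs over the permutations that become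
equal to `τ` once `i` is deleted. -/
theorem sum_eq_zero_of_mem_properElements {𝕜 : Type u} [Field 𝕜] {n : ℕ}
    {θ : Perm (Fin n) →₀ 𝕜} (hθ : θ ∈ properElements 𝕜 n) (i : Fin n) (τ : Perm (Fin n)) :
    ∑ σ : Perm (Fin n) with ∀ a b, a ≠ i → b ≠ i → (σ a < σ b ↔ τ a < τ b), θ σ = 0 := by
  classical
  have h := DFunLike.congr_fun (mem_properElements.1 hθ i) (orderOn ({i}ᶜ : Set (Fin n)) τ)
  rw [Finsupp.lmapDomain_apply, Finsupp.mapDomain, Finsupp.sum_fintype _ _ (by simp),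
    Finsupp.finsetSum_apply] at h
  rw [Finset.sum_filter]
  refine Eq.trans ?_ h
  refine Finset.sum_congr rfl fun σ _ => ?_
  rw [Finsupp.single_apply]
  refine if_congr ?_ rfl rfl
  rw [orderOn_eq_iff]
  constructor
  · intro h a ha b hb
    exact h a b ha hb
  · intro h a b ha hb
    exact h a ha b hb

namespace SymmOperad

variable {𝕜 : Type u} [Field 𝕜]

theorem eq_zero_of_mem_properElements_one {θ : Perm (Fin 1) →₀ 𝕜}
    (hθ : θ ∈ properElements 𝕜 1) : θ = 0 := by
  have h := sum_eq_zero_of_mem_properElements hθ 0 1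
  refine Finsupp.ext fun σ => ?_
  rw [Subsingleton.elim σ 1]
  simpa [Subsingleton.elim _ (0 : Fin 1)] using h

theorem eq_smul_commutator {θ : Perm (Fin 2) →₀ 𝕜} (hθ : θ ∈ properElements 𝕜 2) :
    θ = θ 1 • commutator 𝕜 := by
  have h := sum_eq_zero_of_mem_properElements hθ 0 1
  rw [show (Finset.univ.filter fun σ : Perm (Fin 2) => ∀ a b, a ≠ 0 → b ≠ 0 →
    (σ a < σ b ↔ (1 : Perm (Fin 2)) a < (1 : Perm (Fin 2)) b)) = {1, swap 0 1} by decide,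
    Finset.sum_pair (by decide)] at h
  have hne : (1 : Perm (Fin 2)) ≠ swap 0 1 := by decide
  have hall : ∀ σ : Perm (Fin 2), σ = 1 ∨ σ = swap 0 1 := by decide
  refine Finsupp.ext fun σ => ?_
  rcases hall σ with rfl | rfl
  · simp [commutator, hne.symm]
  · simp [commutator]
    linear_combination h

/-- The element `x [[x₁, x₂], x₃] + y [[x₁, x₃], x₂]` of `𝕜 S_3`. -/
noncomputable def properCubic (x y : 𝕜) : Perm (Fin 3) →₀ 𝕜 :=
  x • Finsupp.single 1 1 + y • Finsupp.single (swap 1 2) 1 +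
    x • Finsupp.single (swap 0 2) 1 + y • Finsupp.single (finRotate 3)⁻¹ 1 -
    (x + y) • Finsupp.single (swap 0 1) 1 - (x + y) • Finsupp.single (finRotate 3) 1

/-- Four of the deletion equations express the other four coefficients through those at `1` and
`swap 1 2`. -/
theorem eq_properCubic {θ : Perm (Fin 3) →₀ 𝕜} (hθ : θ ∈ properElements 𝕜 3) :
    θ = properCubic (θ 1) (θ (swap 1 2)) := by
  have h := sum_eq_zero_of_mem_properElements hθ
  have e1 := h 2 1
  have e2 := h 1 1
  have e3 := h 0 1
  have e4 := h 1 (swap 0 2)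
  rw [show (Finset.univ.filter fun σ : Perm (Fin 3) => ∀ a b, a ≠ 2 → b ≠ 2 →
    (σ a < σ b ↔ (1 : Perm (Fin 3)) a < (1 : Perm (Fin 3)) b)) =
      {1, swap 1 2, finRotate 3} by decide,
    Finset.sum_insert (by decide), Finset.sum_pair (by decide)] at e1
  rw [show (Finset.univ.filter fun σ : Perm (Fin 3) => ∀ a b, a ≠ 1 → b ≠ 1 →
    (σ a < σ b ↔ (1 : Perm (Fin 3)) a < (1 : Perm (Fin 3)) b)) =
      {1, swap 1 2, swap 0 1} by decide,
    Finset.sum_insert (by decide), Finset.sum_pair (by decide)] at e2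
  rw [show (Finset.univ.filter fun σ : Perm (Fin 3) => ∀ a b, a ≠ 0 → b ≠ 0 →
    (σ a < σ b ↔ (1 : Perm (Fin 3)) a < (1 : Perm (Fin 3)) b)) =
      {1, swap 0 1, (finRotate 3)⁻¹} by decide,
    Finset.sum_insert (by decide), Finset.sum_pair (by decide)] at e3
  rw [show (Finset.univ.filter fun σ : Perm (Fin 3) => ∀ a b, a ≠ 1 → b ≠ 1 →
    (σ a < σ b ↔ (swap 0 2 : Perm (Fin 3)) a < (swap 0 2 : Perm (Fin 3)) b)) =
      {finRotate 3, swap 0 2, (finRotate 3)⁻¹} by decide,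
    Finset.sum_insert (by decide), Finset.sum_pair (by decide)] at e4
  have hall : ∀ σ : Perm (Fin 3), σ = 1 ∨ σ = swap 1 2 ∨ σ = swap 0 2 ∨ σ = (finRotate 3)⁻¹ ∨
      σ = swap 0 1 ∨ σ = finRotate 3 := by decide
  refine Finsupp.ext fun σ => ?_
  simp only [properCubic, Finsupp.add_apply, Finsupp.sub_apply, Finsupp.smul_apply,
    Finsupp.single_apply, smul_eq_mul]
  rcases hall σ with rfl | rfl | rfl | rfl | rfl | rfl
  · rw [if_pos rfl, if_neg (by decide), if_neg (by decide), if_neg (by decide),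
      if_neg (by decide), if_neg (by decide)]
    ring
  · rw [if_pos rfl, if_neg (by decide), if_neg (by decide), if_neg (by decide),
      if_neg (by decide), if_neg (by decide)]
    ring
  · rw [if_pos rfl, if_neg (by decide), if_neg (by decide), if_neg (by decide),
      if_neg (by decide), if_neg (by decide)]
    linear_combination e4 - e1 - e3 + e2
  · rw [if_pos rfl, if_neg (by decide), if_neg (by decide), if_neg (by decide),
      if_neg (by decide), if_neg (by decide)]
    linear_combination e3 - e2
  · rw [if_pos rfl, if_neg (by decide), if_neg (by decide), if_neg (by decide),
      if_neg (by decide), if_neg (by decide)]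
    linear_combination e2
  · rw [if_pos rfl, if_neg (by decide), if_neg (by decide), if_neg (by decide),
      if_neg (by decide), if_neg (by decide)]
    linear_combination e1

theorem asEval_properCubic {A : Type v} [Ring A] [Algebra 𝕜 A] (a : Fin 3 → A) :
    asEval 𝕜 (properCubic (1 : 𝕜) 0) a =
      (a 0 * a 1 - a 1 * a 0) * a 2 - a 2 * (a 0 * a 1 - a 1 * a 0) := by
  have h1 : ∀ p, (Equiv.symm (1 : Perm (Fin 3))) p = p := fun _ => rfl
  have h2 : (Equiv.symm (finRotate 3)) 0 = 2 ∧ (Equiv.symm (finRotate 3)) 1 = 0 ∧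
    (Equiv.symm (finRotate 3)) 2 = 1 := by decide
  have h3 : (swap 0 2 : Perm (Fin 3)) 0 = 2 ∧ (swap 0 2 : Perm (Fin 3)) 1 = 1 ∧
    (swap 0 2 : Perm (Fin 3)) 2 = 0 := by decide
  have h4 : (swap 0 1 : Perm (Fin 3)) 0 = 1 ∧ (swap 0 1 : Perm (Fin 3)) 1 = 0 ∧
    (swap 0 1 : Perm (Fin 3)) 2 = 2 := by decide
  simp only [properCubic, zero_smul, one_smul, add_zero, map_add, map_sub, add_apply, sub_apply,
    asEval_single, List.ofFn_succ, List.ofFn_zero, List.prod_cons, List.prod_nil, h1, symm_swap]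
  simp [h2, h3, h4]
  noncomm_ring

theorem lmapDomain_swap_one_two (x y : 𝕜) :
    Finsupp.lmapDomain 𝕜 𝕜 (· * swap 1 2) (properCubic x y) = properCubic y x := by
  have h1 : swap 1 2 * swap 1 2 = (1 : Perm (Fin 3)) := by decide
  have h2 : swap 0 2 * swap 1 2 = (finRotate 3 : Perm (Fin 3))⁻¹ := by decide
  have h3 : (finRotate 3)⁻¹ * swap 1 2 = (swap 0 2 : Perm (Fin 3)) := by decide
  have h4 : swap 0 1 * swap 1 2 = (finRotate 3 : Perm (Fin 3)) := by decide
  have h5 : finRotate 3 * swap 1 2 = (swap 0 1 : Perm (Fin 3)) := by decide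
  simp only [properCubic, map_add, map_sub, map_smul, Finsupp.lmapDomain_apply,
    Finsupp.mapDomain_single, one_mul, h1, h2, h3, h4, h5]
  module

/-- Exchanging `x₁` and `x₂` changes the sign of `[[x₁, x₂], x₃]` and, by the Jacobi identity, turns
`[[x₁, x₃], x₂]` into `[[x₁, x₃], x₂] - [[x₁, x₂], x₃]`. -/
theorem lmapDomain_swap_zero_one (x y : 𝕜) :
    Finsupp.lmapDomain 𝕜 𝕜 (· * swap 0 1) (properCubic x y) = properCubic (-x - y) y := by
  have h1 : swap 1 2 * swap 0 1 = (finRotate 3 : Perm (Fin 3))⁻¹ := by decide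
  have h2 : swap 0 2 * swap 0 1 = (finRotate 3 : Perm (Fin 3)) := by decide
  have h3 : (finRotate 3)⁻¹ * swap 0 1 = (swap 1 2 : Perm (Fin 3)) := by decide
  have h4 : swap 0 1 * swap 0 1 = (1 : Perm (Fin 3)) := by decide
  have h5 : finRotate 3 * swap 0 1 = (swap 0 2 : Perm (Fin 3)) := by decide
  simp only [properCubic, map_add, map_sub, map_smul, Finsupp.lmapDomain_apply,
    Finsupp.mapDomain_single, one_mul, h1, h2, h3, h4, h5]
  module

theorem properCubic_smul (c x y : 𝕜) : properCubic (c * x) (c * y) = c • properCubic x y := by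
  simp only [properCubic]
  module

theorem properCubic_sub (x y x' y' : 𝕜) :
    properCubic (x - x') (y - y') = properCubic x y - properCubic x' y' := by
  simp only [properCubic]
  module

namespace OperadicIdeal

variable (I : (As 𝕜).OperadicIdeal)

theorem commutator_mem {θ : Perm (Fin 2) →₀ 𝕜} (hI : θ ∈ I.part 2)
    (hθ : θ ∈ properElements 𝕜 2) (h0 : θ ≠ 0) : commutator 𝕜 ∈ I.part 2 := by
  have h := eq_smul_commutator hθ
  have hc : θ 1 ≠ 0 := by
    intro hc
    rw [hc, zero_smul] at h
    exact h0 h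
  rw [h] at hI
  exact ((I.part 2).smul_mem_iff hc).1 hI

theorem properElements_two_le (hI : commutator 𝕜 ∈ I.part 2) :
    properElements 𝕜 2 ≤ I.part 2 := by
  intro θ hθ
  rw [eq_smul_commutator hθ]
  exact Submodule.smul_mem _ _ hI

theorem properElements_three_le (hI : properCubic 1 0 ∈ I.part 3) :
    properElements 𝕜 3 ≤ I.part 3 := by
  intro θ hθ
  have h1 : properCubic 0 1 ∈ I.part 3 := by
    rw [← lmapDomain_swap_one_two]
    exact I.mul_mem_part _ hI
  have h2 : properCubic (θ 1) (θ (swap 1 2)) =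
      θ 1 • properCubic 1 0 + θ (swap 1 2) • properCubic 0 1 := by
    simp only [properCubic]
    module
  rw [eq_properCubic hθ, h2]
  exact add_mem (Submodule.smul_mem _ _ hI) (Submodule.smul_mem _ _ h1)

theorem properElements_three_le_of_commutator_mem (hI : commutator 𝕜 ∈ I.part 2) :
    properElements 𝕜 3 ≤ I.part 3 := by
  obtain ⟨ζ, h1, h2⟩ := exists_triple_commutator 𝕜
  -- The two forms of the triple commutator are compared through their values in an algebra without
  -- identities of degree 3.
  have h3 : ζ - properCubic 1 0 ∈ (identityIdeal (upperUnipotentAlgebra 𝕜)).part 3 := by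
    rw [mem_identityIdeal]
    intro a _
    rw [map_sub, sub_apply, h2, asEval_properCubic, sub_self]
  rw [(identityIdeal (upperUnipotentAlgebra 𝕜)).part_eq_bot_of_le (by omega)
    identityIdeal_upperUnipotentAlgebra_four, Submodule.mem_bot, sub_eq_zero] at h3
  exact I.properElements_three_le (h3 ▸ h1 I hI)

/-- Away from characteristic `3`, the proper elements of degree `3` form an irreducible
representation. -/
theorem properElements_three_le_of_mem (h3 : (3 : 𝕜) ≠ 0) {θ : Perm (Fin 3) →₀ 𝕜}
    (hI : θ ∈ I.part 3) (hθ : θ ∈ properElements 𝕜 3) (h0 : θ ≠ 0) :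
    properElements 𝕜 3 ≤ I.part 3 := by
  obtain ⟨x, y, rfl⟩ : ∃ x y, θ = properCubic x y := ⟨_, _, eq_properCubic hθ⟩
  -- Subtracting the image under `x₁ ↔ x₂` leaves `2 * x + y` times `[[x₁, x₂], x₃]`.
  have key : ∀ x y : 𝕜, properCubic x y ∈ I.part 3 → 2 * x + y ≠ 0 →
      properCubic 1 0 ∈ I.part 3 := by
    intro x y hxy hne
    have h1 := I.mul_mem_part (swap 0 1) hxy
    rw [lmapDomain_swap_zero_one] at h1
    have h2 := Submodule.smul_mem _ (2 * x + y)⁻¹ (sub_mem hxy h1)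
    rw [← properCubic_sub, ← properCubic_smul, sub_self, mul_zero,
      show x - (-x - y) = 2 * x + y by ring, inv_mul_cancel₀ hne] at h2
    exact h2
  refine I.properElements_three_le ?_
  -- If this form vanishes, exchange `x` and `y`; both forms vanish only if `3 * x = 0`, and this is
  -- where the characteristic enters.
  by_cases hxy : 2 * x + y = 0
  · refine key y x ?_ fun hyx => h0 ?_
    · rw [← lmapDomain_swap_one_two]
      exact I.mul_mem_part _ hI
    · have hx : x = 0 := by
        have : (3 : 𝕜) * x = 0 := by linear_combination 2 * hxy - hyx
        exact (mul_eq_zero.1 this).resolve_left h3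
      have hy : y = 0 := by
        rw [hx] at hxy
        linear_combination hxy
      simp [hx, hy, properCubic]
  · exact key x y hI hxy

end OperadicIdeal

/-! ### The commutative quotient -/

/-- Evaluation at ones in `𝕜` is the sum of the coefficients; it is multiplicative because `𝕜` is
commutative. -/
theorem augmentation_asComp {n m : ℕ} (k : Fin n → ℕ) (h : ∑ i, k i = m)
    (θ : Perm (Fin n) →₀ 𝕜) (φ : ∀ i, Perm (Fin (k i)) →₀ 𝕜) :
    asEval 𝕜 (asComp 𝕜 k h θ φ) (fun _ => (1 : 𝕜)) =
      asEval 𝕜 θ (fun _ => (1 : 𝕜)) * ∏ i, asEval 𝕜 (φ i) (fun _ => (1 : 𝕜)) := by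
  rw [asEval_asComp, asEval_apply, asEval_apply, Finset.sum_mul]
  refine Finset.sum_congr rfl fun σ _ => ?_
  simp only [List.prod_ofFn, Finset.prod_const_one, smul_eq_mul, mul_one]
  rw [Equiv.prod_comp σ.symm fun i => asEval 𝕜 (φ i) fun _ => (1 : 𝕜)]

theorem isomorphic_of_bijective {P : SymmOperad.{u, v} 𝕜} {Q : SymmOperad.{u, w} 𝕜} (f : Hom P Q)
    (hf : ∀ n, Function.Bijective (f.toFun n)) : Isomorphic P Q := by
  let e := fun n => LinearEquiv.ofBijective (f.toFun n) (hf n)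
  have he : ∀ n x, f.toFun n ((e n).symm x) = x := fun n x => (e n).apply_symm_apply x
  refine ⟨f, ⟨fun n => (e n).symm, fun σ θ => ?_, ?_, fun k h θ φ => ?_⟩,
    fun n x => (e n).symm_apply_apply x, fun n y => (e n).apply_symm_apply y⟩
  · refine (hf _).1 ?_
    change f.toFun _ ((e _).symm _) = f.toFun _ (P.act σ ((e _).symm _))
    rw [f.map_act, he, he]
  · refine (hf _).1 ?_
    change f.toFun _ ((e _).symm _) = _
    rw [f.map_one, he]
  · refine (hf _).1 ?_
    change f.toFun _ ((e _).symm _) = f.toFun _ (P.comp k h ((e _).symm _)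
      fun i => (e _).symm (φ i))
    rw [f.map_comp, he]
    simp only [he]

namespace OperadicIdeal

variable (I : (As 𝕜).OperadicIdeal)

/-- The pattern test with `q = 0`: an empty pattern remembers only the sum of the coefficients. -/
theorem mem_part_iff_augmentation (h0 : I.part 0 = ⊥)
    (hI : ∀ j, 1 ≤ j → properElements 𝕜 j ≤ I.part j) {n : ℕ} (θ : Perm (Fin n) →₀ 𝕜) :
    θ ∈ I.part n ↔ asEval 𝕜 θ (fun _ => (1 : 𝕜)) = 0 := by
  have haug : ∀ f : Fin 0 ↪o Fin n, Finsupp.lmapDomain 𝕜 𝕜 (pattern f) θ =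
      Finsupp.single 1 (asEval 𝕜 θ fun _ => (1 : 𝕜)) := by
    intro f
    have : Finsupp.lmapDomain 𝕜 𝕜 (pattern f) =
        (Finsupp.lsingle 1).comp (evalLinear (asEval 𝕜) fun _ => (1 : 𝕜)) := by
      refine Finsupp.lhom_ext' fun σ => LinearMap.ext_ring ?_
      change Finsupp.lmapDomain 𝕜 𝕜 (pattern f) (Finsupp.single σ 1) =
        Finsupp.single 1 (asEval 𝕜 (Finsupp.single σ 1) fun _ => (1 : 𝕜))
      rw [asEval_single, Subsingleton.elim (1 : Perm (Fin 0)) (pattern f σ)]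
      simp
    exact congrArg (fun g => g θ) this
  constructor
  · intro h
    have h1 := I.pattern_mem_part (Fin.castLEOrderEmb (Nat.zero_le n)) h
    rw [haug, h0, Submodule.mem_bot] at h1
    exact Finsupp.single_eq_zero.1 h1
  · intro h
    refine I.mem_part_of_pattern_mem hI (Nat.zero_le n) fun f => ?_
    rw [haug, h, Finsupp.single_zero]
    exact zero_mem _

theorem isomorphic_com (h0 : I.part 0 = ⊥)
    (hI : ∀ j, 1 ≤ j → properElements 𝕜 j ≤ I.part j) : Isomorphic I.quotient (Com 𝕜) := by
  have hmem := fun {n : ℕ} (θ : Perm (Fin n) →₀ 𝕜) => I.mem_part_iff_augmentation h0 hI θ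
  let aug : ∀ n, (Perm (Fin n) →₀ 𝕜) →ₗ[𝕜] 𝕜 := fun n => evalLinear (asEval 𝕜) fun _ => (1 : 𝕜)
  let F : ∀ n, I.quotientPart n →ₗ[𝕜] 𝕜 := fun n =>
    (I.part n).liftQ (aug n) fun θ hθ => (hmem θ).1 hθ
  let f : Hom I.quotient (Com 𝕜) :=
    { toFun := F
      map_act := by
        intro n σ θ
        obtain ⟨θ, rfl⟩ := Submodule.Quotient.mk_surjective _ θ
        exact asEval_act σ θ fun _ => (1 : 𝕜)
      map_one := asEval_one_one fun _ => (1 : 𝕜)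
      map_comp := by
        intro n m k h θ φ
        obtain ⟨θ, rfl⟩ := Submodule.Quotient.mk_surjective _ θ
        obtain ⟨φ, rfl⟩ := I.exists_reps φ
        refine (congrArg (F m) (I.quotComp_mk k h θ φ)).trans ?_
        exact (augmentation_asComp k h θ φ).trans rfl }
  refine isomorphic_of_bijective f fun n => ⟨?_, fun c => ?_⟩
  · rw [injective_iff_map_eq_zero]
    intro θ hθ
    obtain ⟨θ, rfl⟩ := Submodule.Quotient.mk_surjective _ θ
    exact (Submodule.Quotient.mk_eq_zero _).2 ((hmem θ).2 hθ)
  · let x : Perm (Fin n) →₀ 𝕜 := (show 𝕜 from c) • Finsupp.single 1 1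
    refine ⟨(I.part n).mkQ x, ?_⟩
    change asEval 𝕜 ((show 𝕜 from c) • Finsupp.single (1 : Perm (Fin n)) (1 : 𝕜)) (fun _ => (1 : 𝕜)) = c
    rw [map_smul, smul_apply, asEval_single, List.ofFn_const, List.prod_replicate, one_pow]
    exact mul_one (show 𝕜 from c)

end OperadicIdeal

end SymmOperad

/-! ### The main theorem -/

theorem theorem0p7 (𝕜 : Type*) [Field 𝕜] :
    (∀ I : (SymmOperad.As 𝕜).OperadicIdeal,
      (I.quotient.gkdim = 1 →
        (∀ n, I.carrier n = (SymmOperad.As 𝕜).truncation (SymmOperad.asZeroUnit 𝕜) 1 n) ∧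
        SymmOperad.Isomorphic I.quotient (SymmOperad.Com 𝕜)) ∧
      (I.quotient.gkdim ≠ 2 ∧ ¬ (1 < I.quotient.gkdim ∧ I.quotient.gkdim < 3)) ∧
      (I.quotient.gkdim = 3 →
        ∀ n, I.carrier n = (SymmOperad.As 𝕜).truncation (SymmOperad.asZeroUnit 𝕜) 3 n) ∧
      ((3 : 𝕜) ≠ 0 → I.quotient.gkdim = 4 →
        ∀ n, I.carrier n = (SymmOperad.As 𝕜).truncation (SymmOperad.asZeroUnit 𝕜) 4 n)) ∧
    (∃ I J : (SymmOperad.As 𝕜).OperadicIdeal,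
      I.quotient.gkdim = 5 ∧ J.quotient.gkdim = 5 ∧
      ¬ SymmOperad.Isomorphic I.quotient J.quotient) := by
  refine ⟨fun I => ?_, SymmOperad.exists_nonisomorphic_gkdim_five 𝕜⟩
  have hlt : ∀ {q : ℕ}, I.quotient.gkdim < ((q + 2 : ℕ) : ℝ) →
      ∀ j, q + 1 ≤ j → properElements 𝕜 j ≤ I.part j := fun {q} h j hj =>
    I.properElements_le_of_gkdim_lt (h.trans_le (by exact_mod_cast (by omega : q + 2 ≤ j + 1)))
  have hone : properElements 𝕜 1 ≤ I.part 1 := fun θ hθ => by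
    rw [SymmOperad.eq_zero_of_mem_properElements_one hθ]
    exact zero_mem _
  -- Dimension below 3 puts all proper elements of degree at least 2 into `I`; degree 1 has none but
  -- 0, so the upper bound applies with `q = 0`.
  have hgap : I.quotient.gkdim < 3 → I.quotient.gkdim ≤ 1 := by
    intro h
    have h2 := hlt (q := 1) (by exact_mod_cast h)
    have := I.gkdim_le (q := 0) fun j hj => by
      rcases hj.lt_or_eq with h' | rfl
      · exact h2 j h'
      · exact hone
    simpa using this
  have hzero : I.quotient.gkdim ≠ ⊥ → I.part 0 = ⊥ := fun h => by
    by_contra h0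
    exact h (I.gkdim_eq_bot h0)
  have hpart1 : I.part 0 = ⊥ → I.part 1 = ⊥ := fun h => I.part_succ_eq_bot h fun θ _ hθ =>
    SymmOperad.eq_zero_of_mem_properElements_one hθ
  refine ⟨fun h => ?_, ⟨fun h => ?_, fun h => ?_⟩, fun h => ?_, fun h3 h => ?_⟩
  · have h0 := hzero (by rw [h]; exact (EReal.coe_ne_bot 1))
    have hI := hlt (q := 0) (by rw [h]; exact EReal.coe_lt_coe_iff.2 (by norm_num))
    exact ⟨I.carrier_eq_truncation h0 hI, I.isomorphic_com h0 hI⟩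
  · have := hgap (by rw [h]; exact EReal.coe_lt_coe_iff.2 (by norm_num))
    rw [h] at this
    have h' := EReal.coe_le_coe_iff.1 this
    norm_num at h'
  · exact absurd (hgap h.2) (not_le.2 h.1)
  · have h0 := hzero (by rw [h]; exact (EReal.coe_ne_bot 3))
    have hI := hlt (q := 2) (by rw [h]; exact EReal.coe_lt_coe_iff.2 (by norm_num))
    refine I.carrier_eq_truncation (I.part_succ_eq_bot (hpart1 h0) fun θ h1 h2 => ?_) hI
    by_contra hne
    -- With the commutator in `I`, no proper element of degree at least 2 is missed, and the
    -- dimension would be at most 2.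
    have hc := I.properElements_two_le (I.commutator_mem h1 h2 hne)
    have := I.gkdim_le (q := 1) fun j hj => by
      rcases hj.lt_or_eq with h' | rfl
      · exact hI j h'
      · exact hc
    rw [h] at this
    have h' := EReal.coe_le_coe_iff.1 this
    norm_num at h'
  · have h0 := hzero (by rw [h]; exact (EReal.coe_ne_bot 4))
    have hI := hlt (q := 3) (by rw [h]; exact EReal.coe_lt_coe_iff.2 (by norm_num))
    have hnot : ¬ properElements 𝕜 3 ≤ I.part 3 := fun hle => by
      have := I.gkdim_le (q := 2) fun j hj => by
        rcases hj.lt_or_eq with h' | rfl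
        · exact hI j h'
        · exact hle
      rw [h] at this
      have h' := EReal.coe_le_coe_iff.1 this
      norm_num at h'
    -- A nonzero binary element of `I` would bring in the commutator, and with it all proper
    -- elements of degree 3.
    have hpart2 := I.part_succ_eq_bot (hpart1 h0) fun θ h1 h2 => by
      by_contra hne
      exact hnot (I.properElements_three_le_of_commutator_mem (I.commutator_mem h1 h2 hne))
    refine I.carrier_eq_truncation (I.part_succ_eq_bot hpart2 fun θ h1 h2 => ?_) hI
    by_contra hne
    exact hnot (I.properElements_three_le_of_mem h3 h1 h2 hne)
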